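/- **Setting.** A memoryless network $\mathcal N$ has nodes $\{1,\dots,m\}$, measurable input and output alphabets $\mathcal X^{(v)},\mathcal Y^{(v)}$ for each node $v$, and a conditional distribution $p(\mathbf y\mid\mathbf x)$ (a Markov kernel) of the vector of all channel outputs at one time given the vector of all channel inputs at that time. A rate vector $R=(R^{uv})_{u\ne v}$ has one coordinate for each ordered pair of distinct nodes. A blocklength-$n$ solution with message alphabets $\mathcal W^{uv}$ consists of encoders, giving for each node $v$ and time $t\in\{1,\dots,n\}$ the input $X^{(v)}_t$ as a function of $Y^{(v)}_1,\dots,Y^{(v)}_{t-1}$ and $(W^{vv'})_{v'\neq v}$, and decoders, giving for each $u\ne v$ the estimate $\hat W^{uv}$ as a function of $Y^{(v)}_1,\dots,Y^{(v)}_n$ and $(W^{vv'})_{v'\neq v}$ (all functions measurable). The messages are independent and uniform, and at each time $t$, given the messages and the past outputs, the outputs have law $p(\cdot\mid\mathbf X_t)$. Put $\mathcal W^{uv}_{n,R}=\{1,\dots,\lceil 2^{nR^{uv}}\rceil\}$. A $(\lambda,R)$-solution of blocklength $n$ for $\mathcal N$ is a blocklength-$n$ solution with message alphabets $\mathcal W^{uv}_{n,R}$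 and $\Pr(\hat W^{uv}\ne W^{uv})<\lambda$ for all $u\ne v$. The rate region $\mathscr R(\mathcal N)$ is the closure in $\mathbb R^{m(m-1)}$ of the set of $R\ge 0$ such that for every $\lambda>0$ and all sufficiently large $n$ there is a $(\lambda,R)$-solution of blocklength $n$. The $N$-fold stacked network $\underline{\mathcal N}$ consists of $N$ independent copies (layers) of $\mathcal N$, where all copies of a node collaborate: node $v$ has alphabets $(\mathcal X^{(v)})^N$ and $(\mathcal Y^{(v)})^N$. A $(\lambda,R)$-solution of blocklength $n$ for it is a blocklength-$n$ solution with message alphabets $(\mathcal W^{uv}_{n,R})^N$ for which, for all $u\neq v$, the probability that the estimate of the vector of $N$ messages differs from it is less than $\lambda$. The rate region $\mathscr R(\underline{\mathcal N})$ is the closure of the set of $R\ge0$ such that for every $\lambda>0$ and all sufficiently large $N$ the $N$-fold stacked network has a $(\lambda,R)$-solution of some blocklength $n\ge1$. A stacked $(\lambda,R)$-solution of blocklength $n$ for the $N$-fold stacked network, with inner rates $\tilde R^{uv}>R^{uv}$, is a $(\lambda,R)$-solution of the following form: for each $u\ne v$ the message vector in $(\mathcal W^{uv}_{n,R})^N$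 is mapped by a channel encoder to a vector in $(\mathcal W^{uv}_{n,\tilde R})^N$; one and the same blocklength-$n$ solution for $\mathcal N$ with message alphabets $\mathcal W^{uv}_{n,\tilde R}$ is applied separately in every layer; and the resulting vector of estimates in $(\mathcal W^{uv}_{n,\tilde R})^N$ is mapped by a channel decoder to $(\mathcal W^{uv}_{n,R})^N$. **Theorem.** For every memoryless network $\mathcal N$, $\mathscr R(\mathcal N)=\mathscr R(\underline{\mathcal N})$. Moreover, for every $R$ in the interior of $\mathscr R(\underline{\mathcal N})$ there are a blocklength $n\ge1$, a number $\delta>0$ and a vector $\tilde R$ with $\tilde R^{uv}>R^{uv}$ for all $u\ne v$ such that for every $N\ge1$ there is a stacked $(2^{-N\delta},R)$-solution of blocklength $n$ with inner rates $\tilde R$ for the $N$-fold stacked network. -/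

import Mathlib

open MeasureTheory ProbabilityTheory

universe u v w

/-- Ordered pairs `(s, d)` of distinct nodes: a source and a sink. -/
abbrev NodePair (m : ℕ) : Type := {p : Fin m × Fin m // p.1 ≠ p.2}

/-- The index of the message from node `s` to another node `d`. -/
def outPair {m : ℕ} (s : Fin m) (d : {d : Fin m // d ≠ s}) : NodePair m :=
  ⟨(s, d.1), fun h => d.2 h.symm⟩

/-- Rate vectors, with one real coordinate for each ordered pair of distinct nodes. -/
abbrev RateVector (m : ℕ) : Type := NodePair m → ℝ

/-- A memoryless network with nodes `Fin m`, input alphabets `X v` and output alphabets `Y v`: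
the conditional distribution `p(y | x)` of the vector of all channel outputs at one time
given the vector of all channel inputs at that time. -/
structure Network (m : ℕ) (X : Fin m → Type u) (Y : Fin m → Type v)
    [∀ v, MeasurableSpace (X v)] [∀ v, MeasurableSpace (Y v)] where
  kernel : Kernel (∀ v, X v) (∀ v, Y v)
  isMarkov : IsMarkovKernel kernel

/-- The messages that originate at node `s`, when the message for the pair `p` lies in `M p`. -/
abbrev SourceMessages {m : ℕ} (M : NodePair m → Type w) (s : Fin m) : Type w :=
  ∀ d : {d : Fin m // d ≠ s}, M (outPair s d)

/-- A blocklength-`n` code (a solution) with message alphabets `M p`.  At time `t` (counted from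
`0`) node `v` computes its channel input from the `t` outputs it has received so far and from its
own messages; after `n` time steps the sink `p.1.2` of the pair `p` estimates the message of `p`
from its `n` received outputs and its own messages.  All maps are measurable in the outputs. -/
structure Code {m : ℕ} (X : Fin m → Type u) (Y : Fin m → Type v)
    [∀ v, MeasurableSpace (X v)] [∀ v, MeasurableSpace (Y v)]
    (n : ℕ) (M : NodePair m → Type w) where
  enc : ∀ (v : Fin m) (t : Fin n), (Fin t → Y v) → SourceMessages M v → X v
  measurable_enc : ∀ v t w, Measurable fun y => enc v t y w
  dec : ∀ p : NodePair m, (Fin n → Y p.1.2) → SourceMessages M p.1.2 → M p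
  measurable_dec : ∀ p w a, MeasurableSet {y | dec p y w = a}

namespace Code

variable {m : ℕ} {X : Fin m → Type u} {Y : Fin m → Type v}
  [∀ v, MeasurableSpace (X v)] [∀ v, MeasurableSpace (Y v)]
  {n : ℕ} {M : NodePair m → Type w}

/-- The vector of all channel inputs at time `t`, as a function of the vectors of all channel
outputs at the earlier times, when the messages are `w`. -/
def inputs (S : Code X Y n M) (w : ∀ p, M p) (t : Fin n) (y : Fin t → ∀ v, Y v) : ∀ v, X v :=
  fun v => S.enc v t (fun i => y i v) (fun d => w (outPair v d))

theorem measurable_inputs (S : Code X Y n M) (w : ∀ p, M p) (t : Fin n) :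
    Measurable (S.inputs w t) := by
  refine measurable_pi_lambda _ fun v => ?_
  exact (S.measurable_enc v t fun d => w (outPair v d)).comp
    (measurable_pi_lambda _ fun i => (measurable_pi_apply v).comp (measurable_pi_apply i))

/-- The joint law of the channel outputs at the first `t` times when `S` is operated on the
network `𝒩` with messages `w`: given the past, the outputs at time `t` are distributed according
to `p(· | x)`, where `x` is the vector of inputs at time `t`. -/
noncomputable def outputLaw (S : Code X Y n M) (𝒩 : Network m X Y) (w : ∀ p, M p) :
    (t : ℕ) → t ≤ n → Measure (Fin t → ∀ v, Y v)
  | 0, _ => Measure.dirac Fin.elim0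
  | t + 1, h =>
      ((S.outputLaw 𝒩 w t (Nat.le_of_succ_le h)) ⊗ₘ
        (𝒩.kernel.comap (S.inputs w ⟨t, h⟩) (S.measurable_inputs w ⟨t, h⟩))).map
        fun q => Fin.snoc (α := fun _ => ∀ v, Y v) q.1 q.2

/-- The probability that the message of the pair `p` is decoded incorrectly, when the vector of all
messages is uniformly distributed (so that the messages are independent and uniform). -/
noncomputable def errorProb [∀ p, Fintype (M p)] (S : Code X Y n M) (𝒩 : Network m X Y)
    (p : NodePair m) : ℝ :=
  (∑ w : ∀ q, M q, (S.outputLaw 𝒩 w n le_rfl).real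
      {y | S.dec p (fun t => y t p.1.2) (fun d => w (outPair p.1.2 d)) ≠ w p}) /
    Fintype.card (∀ q, M q)

end Code

namespace Network

variable {m : ℕ} {X : Fin m → Type u} {Y : Fin m → Type v}
  [∀ v, MeasurableSpace (X v)] [∀ v, MeasurableSpace (Y v)]

theorem measurable_stack (𝒩 : Network m X Y) (N : ℕ) :
    Measurable fun x : ∀ v, Fin N → X v =>
      (Measure.pi fun ℓ : Fin N => 𝒩.kernel fun v => x v ℓ).map
        fun (y : Fin N → ∀ v, Y v) (v : Fin m) (ℓ : Fin N) => y ℓ v := by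
  have := 𝒩.isMarkov
  refine (Measure.measurable_map _ (by fun_prop)).comp ?_
  refine Measurable.measure_of_isPiSystem_of_isProbabilityMeasure
    generateFrom_pi.symm isPiSystem_pi ?_
  rintro _ ⟨s, hs, rfl⟩
  simp only [Measure.pi_pi]
  refine Finset.measurable_prod _ fun ℓ _ => ?_
  exact (𝒩.kernel.measurable_coe (hs ℓ trivial)).comp
    (measurable_pi_lambda _ fun v => (measurable_pi_apply ℓ).comp (measurable_pi_apply v))

/-- The `N`-fold stacked network: all `N` copies of node `v` collaborate, so that its input and
output alphabets are `(X v)^N` and `(Y v)^N`, and the `N` copies of the channel act independently,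
one on each layer. -/
noncomputable def stack (𝒩 : Network m X Y) (N : ℕ) :
    Network m (fun v => Fin N → X v) (fun v => Fin N → Y v) where
  kernel :=
    { toFun := fun x => (Measure.pi fun ℓ : Fin N => 𝒩.kernel fun v => x v ℓ).map
        fun (y : Fin N → ∀ v, Y v) (v : Fin m) (ℓ : Fin N) => y ℓ v
      measurable' := 𝒩.measurable_stack N }
  isMarkov := by
    have := 𝒩.isMarkov
    refine ⟨fun x => ?_⟩
    exact Measure.isProbabilityMeasure_map (Measurable.aemeasurable (by fun_prop))

end Network

/-- The message alphabet `{1, …, 2 ^ (n R)}` of blocklength `n` and rate `R p`; as usual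
`2 ^ (n R)` is rounded up to an integer. -/
abbrev Message {m : ℕ} (n : ℕ) (R : RateVector m) (p : NodePair m) : Type :=
  Fin ⌈(2 : ℝ) ^ ((n : ℝ) * R p)⌉₊

/-- The message alphabet `{1, …, 2 ^ (n R)} ^ N` of the `N`-fold stacked network: one message for
each layer. -/
abbrev StackMessage {m : ℕ} (N n : ℕ) (R : RateVector m) (p : NodePair m) : Type :=
  Fin N → Message n R p

/-- A stacked solution: each message vector of `W p ^ N` is encoded by a channel code into
`W' p ^ N`, one and the same blocklength-`n` code is applied separately in each layer, and the
vector of its estimates is passed to the channel decoder. -/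
structure StackedCode {m : ℕ} (X : Fin m → Type u) (Y : Fin m → Type v)
    [∀ v, MeasurableSpace (X v)] [∀ v, MeasurableSpace (Y v)]
    (N n : ℕ) (W W' : NodePair m → Type w) where
  chanEnc : ∀ p, (Fin N → W p) → (Fin N → W' p)
  layer : Code X Y n W'
  chanDec : ∀ p, (Fin N → W' p) → (Fin N → W p)

/-- The code for the stacked network that a stacked solution describes. -/
def StackedCode.toCode {m : ℕ} {X : Fin m → Type u} {Y : Fin m → Type v}
    [∀ v, MeasurableSpace (X v)] [∀ v, MeasurableSpace (Y v)]
    {N n : ℕ} {W W' : NodePair m → Type w} [∀ p, Finite (W' p)] (S : StackedCode X Y N n W W') :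
    Code (fun v => Fin N → X v) (fun v => Fin N → Y v) n (fun p => Fin N → W p) where
  enc v t y w := fun ℓ =>
    S.layer.enc v t (fun i => y i ℓ) (fun d => S.chanEnc (outPair v d) (w d) ℓ)
  measurable_enc v t w := by
    refine measurable_pi_lambda _ fun ℓ => ?_
    exact (S.layer.measurable_enc v t _).comp
      (measurable_pi_lambda _ fun i => (measurable_pi_apply ℓ).comp (measurable_pi_apply i))
  dec p y w := S.chanDec p fun ℓ =>
    S.layer.dec p (fun i => y i ℓ) (fun d => S.chanEnc (outPair p.1.2 d) (w d) ℓ)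
  measurable_dec p w a := by
    let f : (Fin n → Fin N → Y p.1.2) → Fin N → W' p := fun y ℓ =>
      S.layer.dec p (fun i => y i ℓ) (fun d => S.chanEnc (outPair p.1.2 d) (w d) ℓ)
    have hf : ∀ b, MeasurableSet (f ⁻¹' {b}) := fun b => by
      have h : f ⁻¹' {b} = ⋂ ℓ, (fun (y : Fin n → Fin N → Y p.1.2) i => y i ℓ) ⁻¹'
          {y | S.layer.dec p y (fun d => S.chanEnc (outPair p.1.2 d) (w d) ℓ) = b ℓ} := by
        ext y
        simp [f, funext_iff]
      rw [h]
      refine MeasurableSet.iInter fun ℓ => ?_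
      exact (measurable_pi_lambda _ fun i =>
        (measurable_pi_apply ℓ).comp (measurable_pi_apply i)) (S.layer.measurable_dec p _ (b ℓ))
    have h : {y | S.chanDec p (f y) = a} = ⋃ b ∈ {b | S.chanDec p b = a}, f ⁻¹' {b} := by
      ext y
      simp
    exact h ▸ MeasurableSet.biUnion (Set.to_countable _) fun b _ => hf b

namespace Network

variable {m : ℕ} {X : Fin m → Type u} {Y : Fin m → Type v}
  [∀ v, MeasurableSpace (X v)] [∀ v, MeasurableSpace (Y v)]

/-- There is a blocklength-`n` `(ε, R)`-solution for the network. -/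
def HasSolution (𝒩 : Network m X Y) (n : ℕ) (ε : ℝ) (R : RateVector m) : Prop :=
  ∃ S : Code X Y n (Message n R), ∀ p, S.errorProb 𝒩 p < ε

/-- There is a blocklength-`n` `(ε, R)`-solution for the `N`-fold stacked network.  The vectors of
`N` messages have to be reproduced without an error in any layer. -/
def HasStackSolution (𝒩 : Network m X Y) (N n : ℕ) (ε : ℝ) (R : RateVector m) : Prop :=
  ∃ S : Code (fun v => Fin N → X v) (fun v => Fin N → Y v) n (StackMessage N n R),
    ∀ p, S.errorProb (𝒩.stack N) p < ε

/-- There is a blocklength-`n` stacked `(ε, R)`-solution for the `N`-fold stacked network, in which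
the code that is used in every layer has rate vector `R'`. -/
def HasStackedSolution (𝒩 : Network m X Y) (N n : ℕ) (ε : ℝ) (R R' : RateVector m) : Prop :=
  ∃ S : StackedCode X Y N n (Message n R) (Message n R'),
    ∀ p, S.toCode.errorProb (𝒩.stack N) p < ε

/-- The rate region of a network. -/
def rateRegion (𝒩 : Network m X Y) : Set (RateVector m) :=
  closure {R | (∀ p, 0 ≤ R p) ∧
    ∀ ε : ℝ, 0 < ε → ∃ n₀ : ℕ, ∀ n ≥ n₀, 𝒩.HasSolution n ε R}

/-- The rate region of the stacked network: solutions of some (positive) blocklength are required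
for all large numbers `N` of layers. -/
def stackRateRegion (𝒩 : Network m X Y) : Set (RateVector m) :=
  closure {R | (∀ p, 0 ≤ R p) ∧
    ∀ ε : ℝ, 0 < ε → ∃ N₀ : ℕ, ∀ N ≥ N₀, ∃ n : ℕ, 1 ≤ n ∧ 𝒩.HasStackSolution N n ε R}

end Network

/-!
Both inclusions and the exponential bound rest on two ways of relating the stacked network to the
network itself.

*Layers as time.* A code of blocklength `n` for the `N`-fold stacked network is a code of
blocklength `N * n` for the network: one time step of the stacked network is carried out in `N`
successive time steps, one for each layer (`Code.serial`, `Code.errorProb_serial`). Hence rates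
achieved on the stacked network give codes of some arbitrarily large blocklength `L` for the
network, with arbitrarily small error probabilities (`Network.exists_long_code`); but these
blocklengths may be sparse.

*The same code in every layer.* The layers are then independent (`Code.map_outputLaw_layered`), so
that the estimates for a pair arise from its codeword through a memoryless channel, in which the
interference of the other pairs is averaged out by uniform inputs. Without outer coding the union
bound gives `rateRegion ⊆ stackRateRegion`, because the blocklength may depend on `N`.

*Outer coding.* Let `S` be a code with message alphabets `K p` and error probabilities at most `ε`
under uniform messages, used in `N` layers. The outer codebooks of all pairs are drawn
independently and uniformly, which makes the messages in each layer uniform. The decoder looks for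
a codeword at Hamming distance less than `α N` from the estimates. The true codeword is farther
away with probability at most `(2 ε ^ α) ^ N`, and each other codeword is this close with
probability at most `(2 |K p| ^ (-(1 - α))) ^ N` (`sum_codebook_far_le`, `sum_codebook_close_le`).
These bounds hold for every `N`, and some choice of the codebooks is good for all pairs at once
(`exists_codebook`). With `|K p| ≥ 2 ^ (L T p)` and rates below `T`, a small `α`, then a large
`L`, then a small `ε` make both terms as small as desired.

For `R` in the interior of the stacked region this is a stacked solution with error probability
below `2 ^ (-N)` for every `N ≥ 1` (`Network.exists_hasStackedSolution`). For the inclusion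
`stackRateRegion ⊆ rateRegion`, the layers of a code with outer coding are again used in
succession, and a blocklength that is not a multiple of `L` is filled up with idle time
(`Code.extend`); as `L` is now fixed, all large blocklengths are reached at slightly smaller rates
(`Network.exists_hasSolution_smul`).
-/

/-! ### The law of the channel outputs -/

theorem measurable_fin_snoc {β : Type*} [MeasurableSpace β] (t : ℕ) :
    Measurable fun q : (Fin t → β) × β =>
      (Fin.snoc (α := fun _ => β) q.1 q.2 : Fin (t + 1) → β) := by
  refine measurable_pi_lambda _ fun i => ?_
  refine Fin.lastCases ?_ (fun j => ?_) i
  · simpa using measurable_snd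
  · simp only [Fin.snoc_castSucc]
    fun_prop

theorem lintegral_pi_fin_succ {β : Type*} [MeasurableSpace β] {k : ℕ}
    (μ : Fin (k + 1) → Measure β) [∀ i, IsProbabilityMeasure (μ i)]
    {f : (Fin (k + 1) → β) → ENNReal} (hf : Measurable f) :
    ∫⁻ z, f z ∂Measure.pi μ =
      ∫⁻ z, ∫⁻ b, f (Fin.snoc (α := fun _ => β) z b) ∂μ (Fin.last k)
        ∂Measure.pi fun i : Fin k => μ i.castSucc := by
  have h : Measure.pi μ = ((Measure.pi fun i : Fin k => μ i.castSucc).prod (μ (Fin.last k))).map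
      fun q => Fin.snoc (α := fun _ => β) q.1 q.2 := by
    refine Measure.pi_eq fun s hs => ?_
    rw [Measure.map_apply (measurable_fin_snoc k) (MeasurableSet.univ_pi hs),
      Fin.prod_univ_castSucc, ← Measure.pi_pi, ← Measure.prod_prod]
    congr 1
    ext q
    simp [Fin.forall_fin_succ']
  rw [h, lintegral_map hf (measurable_fin_snoc k)]
  exact lintegral_prod _ (hf.comp (measurable_fin_snoc k)).aemeasurable

theorem lintegral_pi_prod {ι : Type*} [Fintype ι] {Ω : Type*} [MeasurableSpace Ω]
    (μ : ι → Measure Ω) [∀ i, IsProbabilityMeasure (μ i)] {f : ι → Ω → ENNReal}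
    (hf : ∀ i, Measurable (f i)) :
    ∫⁻ x, ∏ i, f i (x i) ∂Measure.pi μ = ∏ i, ∫⁻ x, f i x ∂μ i := by
  have h := lintegral_prod_eq_prod_lintegral_of_indepFun (μ := Measure.pi μ) Finset.univ
    (fun i (x : ι → Ω) => f i (x i)) (iIndepFun_pi fun i => (hf i).aemeasurable)
    (fun i => (hf i).comp (measurable_pi_apply i))
  rw [h]
  refine Finset.prod_congr rfl fun i _ => ?_
  exact (measurePreserving_eval μ i).lintegral_comp (hf i)

namespace Code

section

variable {m : ℕ} {X : Fin m → Type u} {Y : Fin m → Type v}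
  [∀ v, MeasurableSpace (X v)] [∀ v, MeasurableSpace (Y v)]
  {n : ℕ} {M : NodePair m → Type w}

theorem isProbabilityMeasure_outputLaw (S : Code X Y n M) (𝒩 : Network m X Y) (w : ∀ p, M p) :
    ∀ (t : ℕ) (h : t ≤ n), IsProbabilityMeasure (S.outputLaw 𝒩 w t h)
  | 0, _ => by unfold outputLaw; infer_instance
  | t + 1, h => by
    have := 𝒩.isMarkov
    have := isProbabilityMeasure_outputLaw S 𝒩 w t (Nat.le_of_succ_le h)
    unfold outputLaw
    exact Measure.isProbabilityMeasure_map (measurable_fin_snoc t).aemeasurable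

theorem lintegral_outputLaw_succ (S : Code X Y n M) (𝒩 : Network m X Y) (w : ∀ p, M p)
    (t : ℕ) (h : t + 1 ≤ n) {f : (Fin (t + 1) → ∀ v, Y v) → ENNReal} (hf : Measurable f) :
    ∫⁻ y, f y ∂S.outputLaw 𝒩 w (t + 1) h =
      ∫⁻ y, ∫⁻ z, f (Fin.snoc (α := fun _ => ∀ v, Y v) y z) ∂𝒩.kernel (S.inputs w ⟨t, h⟩ y)
        ∂S.outputLaw 𝒩 w t (Nat.le_of_succ_le h) := by
  have := 𝒩.isMarkov
  have := isProbabilityMeasure_outputLaw S 𝒩 w t (Nat.le_of_succ_le h)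
  rw [outputLaw, lintegral_map hf (measurable_fin_snoc t)]
  exact Measure.lintegral_compProd (hf.comp (measurable_fin_snoc t))

/-- The law of the outputs up to time `T` only depends on the inputs before time `T`. -/
theorem outputLaw_congr {n' : ℕ} {M' : NodePair m → Type*} (S : Code X Y n M) (S' : Code X Y n' M')
    (𝒩 : Network m X Y) (w : ∀ p, M p) (w' : ∀ p, M' p) :
    ∀ (T : ℕ) (h : T ≤ n) (h' : T ≤ n'),
      (∀ t (ht : t < T), S.inputs w ⟨t, ht.trans_le h⟩ = S'.inputs w' ⟨t, ht.trans_le h'⟩) →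
      S.outputLaw 𝒩 w T h = S'.outputLaw 𝒩 w' T h'
  | 0, _, _, _ => rfl
  | T + 1, h, h', H => by
    have ih := outputLaw_congr S S' 𝒩 w w' T (Nat.le_of_succ_le h) (Nat.le_of_succ_le h')
      fun t ht => H t (ht.trans (Nat.lt_succ_self T))
    refine Measure.ext_of_lintegral _ fun f hf => ?_
    rw [lintegral_outputLaw_succ _ _ _ _ _ hf, lintegral_outputLaw_succ _ _ _ _ _ hf, ih,
      H T (Nat.lt_succ_self T)]

theorem measurableSet_dec_ne (S : Code X Y n M) (p : NodePair m) (w : SourceMessages M p.1.2)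
    (a : M p) :
    MeasurableSet {y : Fin n → ∀ v, Y v | S.dec p (fun t => y t p.1.2) w ≠ a} := by
  have h : Measurable fun (y : Fin n → ∀ v, Y v) t => y t p.1.2 := by fun_prop
  exact (h (S.measurable_dec p w a)).compl

theorem nonempty_input [∀ p, Nonempty (M p)] (S : Code X Y n M) (hn : 0 < n) (v : Fin m) :
    Nonempty (X v) :=
  ⟨S.enc v ⟨0, hn⟩ (fun i => i.elim0) fun _ => Classical.arbitrary _⟩

/-! ### Renaming messages and idle time -/

/-- The code with its messages renamed along bijections. -/
def relabel {M' : NodePair m → Type*} (S : Code X Y n M) (e : ∀ p, M' p ≃ M p) :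
    Code X Y n M' where
  enc v t y w := S.enc v t y fun d => e _ (w d)
  measurable_enc v t _ := S.measurable_enc v t _
  dec p y w := (e p).symm (S.dec p y fun d => e _ (w d))
  measurable_dec p w a := by
    simpa [Equiv.symm_apply_eq] using S.measurable_dec p (fun d => e _ (w d)) (e p a)

theorem errorProb_relabel [∀ p, Fintype (M p)] {M' : NodePair m → Type*} [∀ p, Fintype (M' p)]
    (S : Code X Y n M) (e : ∀ p, M' p ≃ M p) (𝒩 : Network m X Y) (p : NodePair m) :
    (S.relabel e).errorProb 𝒩 p = S.errorProb 𝒩 p := by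
  unfold errorProb
  rw [Fintype.card_congr (Equiv.piCongrRight e)]
  congr 1
  refine Fintype.sum_equiv (Equiv.piCongrRight e) _ _ fun w => ?_
  rw [outputLaw_congr (S.relabel e) S 𝒩 w (Equiv.piCongrRight e w) n le_rfl le_rfl fun _ _ => rfl]
  simp [relabel, Equiv.symm_apply_eq]

open Classical in
/-- The code followed by idle time: after time `n` the nodes send arbitrary inputs, and the
decoders ignore the outputs. -/
noncomputable def extend [∀ v, Nonempty (X v)] (S : Code X Y n M) {n' : ℕ} (h : n ≤ n') :
    Code X Y n' M where
  enc v t y w := if ht : t.1 < n then S.enc v ⟨t, ht⟩ y w else Classical.arbitrary _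
  measurable_enc v t w := by
    split_ifs with ht
    · exact S.measurable_enc v ⟨t, ht⟩ w
    · exact measurable_const
  dec p y w := S.dec p (fun i => y (Fin.castLE h i)) w
  measurable_dec p w a := by
    have hm : Measurable fun (y : Fin n' → Y p.1.2) (i : Fin n) => y (Fin.castLE h i) := by fun_prop
    exact hm (S.measurable_dec p w a)

theorem map_outputLaw_castLE (S : Code X Y n M) (𝒩 : Network m X Y) (w : ∀ p, M p) (t : ℕ) :
    ∀ (j : ℕ) (h : t + j ≤ n),
      (S.outputLaw 𝒩 w (t + j) h).map
          (fun y (i : Fin t) => y (Fin.castLE (Nat.le_add_right t j) i)) =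
        S.outputLaw 𝒩 w t ((Nat.le_add_right t j).trans h)
  | 0, h => Measure.map_id
  | j + 1, h => by
    have := 𝒩.isMarkov
    rw [← map_outputLaw_castLE S 𝒩 w t j (Nat.le_of_succ_le h)]
    refine Measure.ext_of_lintegral _ fun f hf => ?_
    have hc : ∀ j, Measurable fun (y : Fin (t + j) → ∀ v, Y v) (i : Fin t) =>
      y (Fin.castLE (Nat.le_add_right t j) i) := fun j => by fun_prop
    rw [lintegral_map hf (hc _), lintegral_map hf (hc _)]
    refine (lintegral_outputLaw_succ S 𝒩 w (t + j) h (hf.comp (hc (j + 1)))).trans ?_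
    refine lintegral_congr fun y => ?_
    have hy : ∀ z : ∀ v, Y v, (fun i : Fin t => (Fin.snoc (α := fun _ => ∀ v, Y v) y z :
        Fin (t + j + 1) → ∀ v, Y v) (Fin.castLE (Nat.le_add_right t (j + 1)) i)) =
        fun i : Fin t => y (Fin.castLE (Nat.le_add_right t j) i) := fun z => by
      funext i
      exact Fin.snoc_castSucc (α := fun _ => ∀ v, Y v) z y (Fin.castLE (Nat.le_add_right t j) i)
    simp [hy]

theorem errorProb_extend [∀ p, Fintype (M p)] [∀ v, Nonempty (X v)] (S : Code X Y n M) {n' : ℕ}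
    (h : n ≤ n') (𝒩 : Network m X Y) (p : NodePair m) :
    (S.extend h).errorProb 𝒩 p = S.errorProb 𝒩 p := by
  obtain ⟨j, rfl⟩ := Nat.exists_eq_add_of_le h
  unfold errorProb
  congr 1
  refine Finset.sum_congr rfl fun w _ => ?_
  have e : (S.extend h).outputLaw 𝒩 w n h = S.outputLaw 𝒩 w n le_rfl :=
    outputLaw_congr _ _ 𝒩 w w n h le_rfl fun t ht => by
      funext y v
      simp [inputs, extend, ht]
  rw [← e, ← map_outputLaw_castLE _ 𝒩 w n j le_rfl,
    map_measureReal_apply (by fun_prop) (S.measurableSet_dec_ne p _ _)]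
  rfl

end

end Code

/-! ### Layers in succession -/

theorem mul_add_lt_of_lt_div {N i t : ℕ} (hi : i < t / N) (ℓ : Fin N) : N * i + ℓ < t :=
  calc N * i + ℓ < N * i + N := by omega
    _ = N * (i + 1) := (Nat.mul_succ N i).symm
    _ ≤ N * (t / N) := Nat.mul_le_mul_left N hi
    _ ≤ t := Nat.mul_div_le t N

theorem mul_add_lt_mul {N i a : ℕ} (hi : i < a) (ℓ : Fin N) : N * i + ℓ < N * a :=
  calc N * i + ℓ < N * i + N := by omega
    _ = N * (i + 1) := (Nat.mul_succ N i).symm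
    _ ≤ N * a := Nat.mul_le_mul_left N hi

/-- Regards `N * a` symbols in succession as `a` vectors of `N` symbols. -/
def regroup {β : Type*} {N : ℕ} (a : ℕ) (y : Fin (N * a) → β) (i : Fin a) (ℓ : Fin N) : β :=
  y ⟨N * i + ℓ, mul_add_lt_mul i.2 ℓ⟩

namespace Code

section

variable {m : ℕ} {X : Fin m → Type u} {Y : Fin m → Type v}
  [∀ v, MeasurableSpace (X v)] [∀ v, MeasurableSpace (Y v)]
  {N n : ℕ} {M : NodePair m → Type w}

/-- The code for the network itself that uses a code for the `N`-fold stacked network with the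
layers in succession: one time step of the stacked network takes `N` time steps. -/
def serial (S : Code (fun v => Fin N → X v) (fun v => Fin N → Y v) n M) (hN : 0 < N) :
    Code X Y (N * n) M where
  enc v t y w := S.enc v ⟨t / N, Nat.div_lt_of_lt_mul t.2⟩
    (fun i ℓ => y ⟨N * i + ℓ, mul_add_lt_of_lt_div i.2 ℓ⟩) w ⟨t % N, Nat.mod_lt _ hN⟩
  measurable_enc v t w := by
    refine (measurable_pi_apply _).comp ((S.measurable_enc v _ w).comp ?_)
    fun_prop
  dec p y w := S.dec p (regroup n y) w
  measurable_dec p w a := by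
    have hm : Measurable fun (y : Fin (N * n) → Y p.1.2) => regroup n y := by
      unfold regroup
      fun_prop
    exact hm (S.measurable_dec p w a)

theorem inputs_serial (S : Code (fun v => Fin N → X v) (fun v => Fin N → Y v) n M) (hN : 0 < N)
    (w : ∀ p, M p) {a k : ℕ} (ha : a < n) (hk : k < N) (h : N * a + k < N * n)
    (y : Fin (N * a) → ∀ v, Y v) (z : Fin k → ∀ v, Y v) (v : Fin m) :
    (S.serial hN).inputs w ⟨N * a + k, h⟩ (Fin.append y z) v =
      S.inputs w ⟨a, ha⟩ (fun i v ℓ => regroup a y i ℓ v) v ⟨k, hk⟩ := by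
  have key : ∀ (b c t : ℕ) (hb : t / N = b) (hc : t % N = c) (ht : t < N * n)
      (x : Fin t → Y v) (u : SourceMessages M v),
      (S.serial hN).enc v ⟨t, ht⟩ x u =
        S.enc v ⟨b, hb ▸ Nat.div_lt_of_lt_mul ht⟩
          (fun i ℓ => x ⟨N * i + ℓ, mul_add_lt_of_lt_div (i.2.trans_eq hb.symm) ℓ⟩) u
          ⟨c, hc ▸ Nat.mod_lt _ hN⟩ := by
    rintro b c t rfl rfl ht x u
    rfl
  refine (key a k (N * a + k) ?_ ?_ h _ _).trans ?_
  · rw [Nat.mul_add_div hN, Nat.div_eq_of_lt hk, add_zero]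
  · rw [Nat.mul_add_mod, Nat.mod_eq_of_lt hk]
  · have e : ∀ (i : Fin a) (ℓ : Fin N) (hi : N * i + ℓ < N * a + k),
        Fin.append y z ⟨N * i + ℓ, hi⟩ = regroup a y i ℓ := fun i ℓ hi =>
      Fin.append_left y z ⟨N * i + ℓ, mul_add_lt_mul i.2 ℓ⟩
    simp only [e]
    rfl

/-- During one time step of the stacked network the layers act independently. -/
theorem lintegral_outputLaw_serial_add (S : Code (fun v => Fin N → X v) (fun v => Fin N → Y v) n M)
    (hN : 0 < N) (𝒩 : Network m X Y) (w : ∀ p, M p) {a : ℕ} (ha : a < n) :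
    ∀ (k : ℕ) (hk : k ≤ N) (h : N * a + k ≤ N * n) (f : (Fin (N * a + k) → ∀ v, Y v) → ENNReal),
      Measurable f →
      ∫⁻ y, f y ∂(S.serial hN).outputLaw 𝒩 w (N * a + k) h =
        ∫⁻ y, ∫⁻ z, f (Fin.append y z)
          ∂(Measure.pi fun i : Fin k => 𝒩.kernel fun v =>
            S.inputs w ⟨a, ha⟩ (fun i v ℓ => regroup a y i ℓ v) v (Fin.castLE hk i))
          ∂(S.serial hN).outputLaw 𝒩 w (N * a) ((Nat.le_add_right _ k).trans h)
  | 0, hk, h, f, hf => by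
    have := 𝒩.isMarkov
    refine lintegral_congr fun y => ?_
    have e : ∀ z : Fin 0 → ∀ v, Y v, Fin.append y z = y := fun z =>
      funext fun i => Fin.append_left y z i
    simp [e]
  | k + 1, hk, h, f, hf => by
    have := 𝒩.isMarkov
    refine (lintegral_outputLaw_succ (S.serial hN) 𝒩 w (N * a + k) h hf).trans ?_
    have hG : Measurable fun y : Fin (N * a + k) → ∀ v, Y v =>
        ∫⁻ z, f (Fin.snoc (α := fun _ => ∀ v, Y v) y z)
          ∂𝒩.kernel ((S.serial hN).inputs w ⟨N * a + k, h⟩ y) :=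
      Measurable.lintegral_kernel_prod_right' (κ := 𝒩.kernel.comap _
        ((S.serial hN).measurable_inputs w ⟨N * a + k, h⟩)) (hf.comp (measurable_fin_snoc _))
    rw [lintegral_outputLaw_serial_add S hN 𝒩 w ha k (Nat.le_of_succ_le hk) _ _ hG]
    refine lintegral_congr fun y => ?_
    have hy : Measurable fun z : Fin (k + 1) → ∀ v, Y v => f (Fin.append y z) := by
      refine hf.comp (measurable_pi_lambda _ fun i => ?_)
      refine Fin.addCases (fun j => ?_) (fun j => ?_) i
      · simp only [Fin.append_left]
        exact measurable_const
      · simp only [Fin.append_right]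
        fun_prop
    rw [lintegral_pi_fin_succ _ hy]
    refine lintegral_congr fun z => ?_
    have e : (S.serial hN).inputs w ⟨N * a + k, h⟩ (Fin.append y z) = fun v =>
        S.inputs w ⟨a, ha⟩ (fun i v ℓ => regroup a y i ℓ v) v (Fin.castLE hk (Fin.last k)) :=
      funext fun v => inputs_serial S hN w ha hk h y z v
    rw [e]
    refine lintegral_congr fun b => ?_
    rw [Fin.append_snoc]

theorem map_outputLaw_serial (S : Code (fun v => Fin N → X v) (fun v => Fin N → Y v) n M)
    (hN : 0 < N) (𝒩 : Network m X Y) (w : ∀ p, M p) :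
    ∀ (a : ℕ) (ha : a ≤ n),
      ((S.serial hN).outputLaw 𝒩 w (N * a) (Nat.mul_le_mul_left N ha)).map
          (fun (y : Fin (N * a) → ∀ v, Y v) i v ℓ => regroup a y i ℓ v) =
        S.outputLaw (𝒩.stack N) w a ha
  | 0, ha => by
    have : IsProbabilityMeasure ((S.serial hN).outputLaw 𝒩 w (N * 0) (Nat.mul_le_mul_left N ha)) :=
      isProbabilityMeasure_outputLaw _ _ _ _ _
    have e : (fun (y : Fin (N * 0) → ∀ v, Y v) i v ℓ => regroup 0 y i ℓ v) =
        fun _ => (Fin.elim0 : Fin 0 → ∀ v, Fin N → Y v) := funext fun y => Subsingleton.elim _ _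
    rw [e, Measure.map_const, measure_univ, one_smul]
    rfl
  | a + 1, ha => by
    have := 𝒩.isMarkov
    have := (𝒩.stack N).isMarkov
    have hr : ∀ a, Measurable fun (y : Fin (N * a) → ∀ v, Y v) i v ℓ => regroup a y i ℓ v :=
      fun a => by unfold regroup; fun_prop
    refine Measure.ext_of_lintegral _ fun f hf => ?_
    rw [lintegral_map hf (hr _), lintegral_outputLaw_succ _ _ _ _ _ hf,
      ← map_outputLaw_serial S hN 𝒩 w a (Nat.le_of_succ_le ha), lintegral_map _ (hr a)]
    · refine (lintegral_outputLaw_serial_add S hN 𝒩 w ha N le_rfl (Nat.mul_le_mul_left N ha) _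
        (hf.comp (hr (a + 1)))).trans ?_
      refine lintegral_congr fun y => ?_
      have hT : Measurable fun (z : Fin N → ∀ v, Y v) (v : Fin m) (ℓ : Fin N) => z ℓ v := by
        fun_prop
      have hs : Measurable fun z : ∀ v, Fin N → Y v =>
          f (Fin.snoc (α := fun _ => ∀ v, Fin N → Y v) (fun i v ℓ => regroup a y i ℓ v) z) :=
        (hf.comp (measurable_fin_snoc a)).comp
          (measurable_prodMk_left (x := fun i v ℓ => regroup a y i ℓ v))
      refine Eq.trans ?_ (lintegral_map hs hT).symm
      refine lintegral_congr fun z => ?_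
      simp only [Function.comp]
      congr 1
      funext i v ℓ
      refine Fin.lastCases ?_ (fun j => ?_) i
      · simp only [Fin.snoc_last]
        exact congrFun (Fin.append_right y z ℓ) v
      · simp only [Fin.snoc_castSucc]
        exact congrFun (Fin.append_left y z ⟨N * j + ℓ, mul_add_lt_mul j.2 ℓ⟩) v
    · exact Measurable.lintegral_kernel_prod_right' (κ := (𝒩.stack N).kernel.comap _
        (S.measurable_inputs w ⟨a, ha⟩)) (hf.comp (measurable_fin_snoc _))

theorem errorProb_serial [∀ p, Fintype (M p)]
    (S : Code (fun v => Fin N → X v) (fun v => Fin N → Y v) n M) (hN : 0 < N)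
    (𝒩 : Network m X Y) (p : NodePair m) :
    (S.serial hN).errorProb 𝒩 p = S.errorProb (𝒩.stack N) p := by
  unfold errorProb
  congr 1
  refine Finset.sum_congr rfl fun w _ => ?_
  have hr : Measurable fun (y : Fin (N * n) → ∀ v, Y v) i v ℓ => regroup n y i ℓ v := by
    unfold regroup
    fun_prop
  rw [← map_outputLaw_serial S hN 𝒩 w n le_rfl,
    map_measureReal_apply hr (S.measurableSet_dec_ne p _ _)]
  rfl

end

end Code

/-! ### The same code in every layer -/

theorem measureReal_eq_sum_fiber {Ω K : Type*} [MeasurableSpace Ω] [Fintype K] (μ : Measure Ω)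
    [IsFiniteMeasure μ] {g : Ω → K} (hg : ∀ k, MeasurableSet {y | g y = k}) (P : K → Prop)
    [DecidablePred P] : μ.real {y | P (g y)} = ∑ k with P k, μ.real {y | g y = k} := by
  rw [← measureReal_biUnion_finset (fun a _ b _ hab => Set.disjoint_left.2 fun y ha hb =>
    hab (ha.symm.trans hb)) fun k _ => hg k]
  congr 1
  ext y
  simp

namespace Code

section

variable {m : ℕ} {X : Fin m → Type u} {Y : Fin m → Type v}
  [∀ v, MeasurableSpace (X v)] [∀ v, MeasurableSpace (Y v)]
  {N n : ℕ} {K : NodePair m → Type w}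

theorem outputLaw_succ_apply (S : Code X Y n K) (𝒩 : Network m X Y) (w : ∀ p, K p) (t : ℕ)
    (h : t + 1 ≤ n) {A : Set (Fin (t + 1) → ∀ v, Y v)} (hA : MeasurableSet A) :
    S.outputLaw 𝒩 w (t + 1) h A =
      ∫⁻ y, 𝒩.kernel (S.inputs w ⟨t, h⟩ y) {z | Fin.snoc (α := fun _ => ∀ v, Y v) y z ∈ A}
        ∂S.outputLaw 𝒩 w t (Nat.le_of_succ_le h) := by
  have := 𝒩.isMarkov
  have := isProbabilityMeasure_outputLaw S 𝒩 w t (Nat.le_of_succ_le h)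
  rw [outputLaw, Measure.map_apply (measurable_fin_snoc t) hA,
    Measure.compProd_apply (measurable_fin_snoc t hA)]
  rfl

/-- The probability that the message of the pair `p` is estimated to be `k` when the messages
are `w`. -/
noncomputable def estimateProb (S : Code X Y n K) (𝒩 : Network m X Y) (p : NodePair m)
    (w : ∀ q, K q) (k : K p) : ℝ :=
  (S.outputLaw 𝒩 w n le_rfl).real
    {y | S.dec p (fun t => y t p.1.2) (fun d => w (outPair p.1.2 d)) = k}

theorem estimateProb_nonneg (S : Code X Y n K) (𝒩 : Network m X Y) (p : NodePair m)
    (b : ∀ q, K q) (k : K p) : 0 ≤ S.estimateProb 𝒩 p b k := measureReal_nonneg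

theorem measurableSet_dec_eq (S : Code X Y n K) (p : NodePair m) (w : SourceMessages K p.1.2)
    (k : K p) : MeasurableSet {y : Fin n → ∀ v, Y v | S.dec p (fun t => y t p.1.2) w = k} := by
  have h : Measurable fun (y : Fin n → ∀ v, Y v) t => y t p.1.2 := by fun_prop
  exact h (S.measurable_dec p w k)

theorem sum_estimateProb [∀ p, Fintype (K p)] (S : Code X Y n K) (𝒩 : Network m X Y)
    (p : NodePair m) (w : ∀ q, K q) : ∑ k, S.estimateProb 𝒩 p w k = 1 := by
  classical
  have := isProbabilityMeasure_outputLaw S 𝒩 w n le_rfl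
  have h := measureReal_eq_sum_fiber (S.outputLaw 𝒩 w n le_rfl)
    (S.measurableSet_dec_eq p fun d => w (outPair p.1.2 d)) fun _ => True
  simpa [estimateProb] using h.symm

open Classical in
theorem errorProb_eq_sum_estimateProb [∀ p, Fintype (K p)] (S : Code X Y n K) (𝒩 : Network m X Y)
    (p : NodePair m) :
    S.errorProb 𝒩 p =
      (∑ w : ∀ q, K q, ∑ k with k ≠ w p, S.estimateProb 𝒩 p w k) / Fintype.card (∀ q, K q) := by
  unfold errorProb
  congr 1
  refine Finset.sum_congr rfl fun w _ => ?_
  have := isProbabilityMeasure_outputLaw S 𝒩 w n le_rfl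
  exact measureReal_eq_sum_fiber (S.outputLaw 𝒩 w n le_rfl)
    (S.measurableSet_dec_eq p fun d => w (outPair p.1.2 d)) fun k => k ≠ w p

/-- The code for the stacked network that maps each message to a codeword with `N` letters, uses
one and the same code `S` in each layer, and decodes the vector of estimates. -/
def layered {M : NodePair m → Type*} [∀ p, Finite (K p)] (S : Code X Y n K)
    (φ : ∀ p, M p → Fin N → K p) (ψ : ∀ p, (Fin N → K p) → M p) :
    Code (fun v => Fin N → X v) (fun v => Fin N → Y v) n M where
  enc v t y w := fun ℓ => S.enc v t (fun i => y i ℓ) (fun d => φ (outPair v d) (w d) ℓ)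
  measurable_enc v t w := by
    refine measurable_pi_lambda _ fun ℓ => ?_
    exact (S.measurable_enc v t _).comp
      (measurable_pi_lambda _ fun i => (measurable_pi_apply ℓ).comp (measurable_pi_apply i))
  dec p y w := ψ p fun ℓ => S.dec p (fun i => y i ℓ) (fun d => φ (outPair p.1.2 d) (w d) ℓ)
  measurable_dec p w a := by
    let : MeasurableSpace (K p) := ⊤
    have hf : Measurable fun (y : Fin n → Fin N → Y p.1.2) (ℓ : Fin N) =>
        S.dec p (fun i => y i ℓ) (fun d => φ (outPair p.1.2 d) (w d) ℓ) := by
      refine measurable_pi_lambda _ fun ℓ => measurable_to_countable' fun k => ?_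
      have hm : Measurable fun (y : Fin n → Fin N → Y p.1.2) i => y i ℓ := by fun_prop
      exact hm (S.measurable_dec p _ k)
    exact hf (Set.to_countable {k | ψ p k = a}).measurableSet

/-- When the same code is used in every layer, the layers are independent. -/
theorem map_outputLaw_layered {M : NodePair m → Type*} [∀ p, Finite (K p)] (S : Code X Y n K)
    (𝒩 : Network m X Y) (φ : ∀ p, M p → Fin N → K p) (ψ : ∀ p, (Fin N → K p) → M p)
    (w : ∀ p, M p) :
    ∀ (t : ℕ) (h : t ≤ n),
      ((S.layered φ ψ).outputLaw (𝒩.stack N) w t h).map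
          (fun (y : Fin t → ∀ v, Fin N → Y v) ℓ i v => y i v ℓ) =
        Measure.pi fun ℓ => S.outputLaw 𝒩 (fun q => φ q (w q) ℓ) t h
  | 0, h => by
    have := fun ℓ => isProbabilityMeasure_outputLaw S 𝒩 (fun q => φ q (w q) ℓ) 0 h
    have := isProbabilityMeasure_outputLaw (S.layered φ ψ) (𝒩.stack N) w 0 h
    have hT : Measurable fun (y : Fin 0 → ∀ v, Fin N → Y v) (ℓ : Fin N) i v => y i v ℓ := by
      fun_prop
    have := Measure.isProbabilityMeasure_map
      (μ := (S.layered φ ψ).outputLaw (𝒩.stack N) w 0 h) hT.aemeasurable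
    ext s -
    obtain rfl | rfl := s.eq_empty_or_nonempty.imp_right Set.Nonempty.eq_univ <;> simp
  | t + 1, h => by
    have := 𝒩.isMarkov
    have := fun t h ℓ => isProbabilityMeasure_outputLaw S 𝒩 (fun q => φ q (w q) ℓ) t h
    have hT : ∀ t, Measurable fun (y : Fin t → ∀ v, Fin N → Y v) (ℓ : Fin N) i v => y i v ℓ :=
      fun t => by fun_prop
    refine (Measure.pi_eq fun s hs => ?_).symm
    have hg : ∀ ℓ, Measurable fun y => 𝒩.kernel (S.inputs (fun q => φ q (w q) ℓ) ⟨t, h⟩ y)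
        {z | Fin.snoc (α := fun _ => ∀ v, Y v) y z ∈ s ℓ} := fun ℓ =>
      Kernel.measurable_kernel_prodMk_left (κ := 𝒩.kernel.comap _
        (S.measurable_inputs (fun q => φ q (w q) ℓ) ⟨t, h⟩)) (measurable_fin_snoc t (hs ℓ))
    have hG : Measurable fun y : Fin N → Fin t → ∀ v, Y v =>
        ∏ ℓ, 𝒩.kernel (S.inputs (fun q => φ q (w q) ℓ) ⟨t, h⟩ (y ℓ))
          {z | Fin.snoc (α := fun _ => ∀ v, Y v) (y ℓ) z ∈ s ℓ} :=
      Finset.measurable_prod _ fun ℓ _ => (hg ℓ).comp (measurable_pi_apply ℓ)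
    simp_rw [fun ℓ => outputLaw_succ_apply S 𝒩 (fun q => φ q (w q) ℓ) t h (hs ℓ)]
    rw [← lintegral_pi_prod _ hg, ← map_outputLaw_layered S 𝒩 φ ψ w t (Nat.le_of_succ_le h),
      lintegral_map hG (hT t),
      Measure.map_apply (hT (t + 1)) (MeasurableSet.univ_pi hs),
      outputLaw_succ_apply _ _ _ _ _ (hT (t + 1) (MeasurableSet.univ_pi hs))]
    refine lintegral_congr fun y => ?_
    rw [← Measure.pi_pi]
    have hT' : Measurable fun (z : Fin N → ∀ v, Y v) (v : Fin m) (ℓ : Fin N) => z ℓ v := by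
      fun_prop
    refine (Measure.map_apply hT' ?_).trans ?_
    · exact (measurable_fin_snoc t).comp (measurable_prodMk_left (x := y))
        (hT (t + 1) (MeasurableSet.univ_pi hs))
    · congr 1
      ext z
      simp only [Set.mem_preimage, Set.mem_ofPred_eq, Set.mem_univ_pi]
      refine forall_congr' fun ℓ => ?_
      have e : (fun i v => (Fin.snoc (α := fun _ => ∀ v, Fin N → Y v) y (fun v ℓ => z ℓ v) :
          Fin (t + 1) → ∀ v, Fin N → Y v) i v ℓ) =
          Fin.snoc (α := fun _ => ∀ v, Y v) (fun i v => y i v ℓ) (z ℓ) := by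
        funext i
        refine Fin.lastCases ?_ (fun j => ?_) i <;> simp
      rw [e]

open Classical in
theorem errorProb_layered {M : NodePair m → Type*} [∀ p, Fintype (M p)] [∀ p, Fintype (K p)]
    (S : Code X Y n K) (𝒩 : Network m X Y) (φ : ∀ p, M p → Fin N → K p)
    (ψ : ∀ p, (Fin N → K p) → M p) (p : NodePair m) :
    (S.layered φ ψ).errorProb (𝒩.stack N) p =
      (∑ w : ∀ q, M q, ∑ k with ψ p k ≠ w p,
        ∏ ℓ, S.estimateProb 𝒩 p (fun q => φ q (w q) ℓ) (k ℓ)) / Fintype.card (∀ q, M q) := by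
  unfold errorProb
  congr 1
  refine Finset.sum_congr rfl fun w _ => ?_
  have := isProbabilityMeasure_outputLaw (S.layered φ ψ) (𝒩.stack N) w n le_rfl
  have := fun ℓ => isProbabilityMeasure_outputLaw S 𝒩 (fun q => φ q (w q) ℓ) n le_rfl
  have hT : Measurable fun (y : Fin n → ∀ v, Fin N → Y v) (ℓ : Fin N) i v => y i v ℓ := by
    fun_prop
  have hE : ∀ k : Fin N → K p, MeasurableSet (Set.univ.pi fun ℓ =>
      {y : Fin n → ∀ v, Y v | S.dec p (fun t => y t p.1.2)
        (fun d => φ _ (w (outPair p.1.2 d)) ℓ) = k ℓ}) := fun k =>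
    MeasurableSet.univ_pi fun ℓ => S.measurableSet_dec_eq p _ _
  have hset : ∀ k : Fin N → K p, {y : Fin n → ∀ v, Fin N → Y v | (fun ℓ =>
      S.dec p (fun t => y t p.1.2 ℓ) fun d => φ _ (w (outPair p.1.2 d)) ℓ) = k} =
      (fun y (ℓ : Fin N) i v => y i v ℓ) ⁻¹' (Set.univ.pi fun ℓ =>
        {y | S.dec p (fun t => y t p.1.2) (fun d => φ _ (w (outPair p.1.2 d)) ℓ) = k ℓ}) :=
    fun k => by
      ext y
      simp [funext_iff]
  refine (measureReal_eq_sum_fiber _ (g := fun (y : Fin n → ∀ v, Fin N → Y v) ℓ =>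
    S.dec p (fun t => y t p.1.2 ℓ) fun d => φ _ (w (outPair p.1.2 d)) ℓ)
    (fun k => hset k ▸ hT (hE k)) fun k => ψ p k ≠ w p).trans ?_
  refine Finset.sum_congr rfl fun k _ => ?_
  rw [hset, ← map_measureReal_apply hT (hE k), map_outputLaw_layered, measureReal_def,
    Measure.pi_pi, ENNReal.toReal_prod]
  rfl

end

end Code

/-! ### Random codebooks -/

/-- Averaging principle: if `upd x a` resets the coordinate `ev x` of `x` to `a`, then resetting it
to a uniform value does not change sums over all `x`. -/
theorem sum_sum_reset {Ω A : Type*} [Fintype Ω] [Fintype A] (upd : Ω → A → Ω) (ev : Ω → A)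
    (hev : ∀ x a, ev (upd x a) = a) (hupd : ∀ x a, upd (upd x a) (ev x) = x) (f : Ω → ℝ) :
    ∑ x, ∑ a, f (upd x a) = Fintype.card A * ∑ x, f x := by
  -- `(x, a) ↦ (upd x a, ev x)` is an involution
  let e : Ω × A ≃ Ω × A :=
    { toFun := fun q => (upd q.1 q.2, ev q.1)
      invFun := fun q => (upd q.1 q.2, ev q.1)
      left_inv := fun q => Prod.ext (hupd _ _) (hev _ _)
      right_inv := fun q => Prod.ext (hupd _ _) (hev _ _) }
  calc ∑ x, ∑ a, f (upd x a) = ∑ q : Ω × A, f (e q).1 :=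
        (Fintype.sum_prod_type fun q : Ω × A => f (upd q.1 q.2)).symm
    _ = ∑ q : Ω × A, f q.1 := Equiv.sum_comp e fun q => f q.1
    _ = Fintype.card A * ∑ x, f x := by
      rw [Fintype.sum_prod_type]
      simp [Finset.mul_sum]

theorem prod_ite_ne_eq_pow_hammingDist {K : Type*} [DecidableEq K] {N : ℕ} (k c : Fin N → K)
    (z : ℝ) : (∏ ℓ, if k ℓ ≠ c ℓ then z else 1) = z ^ hammingDist k c := by
  simp [Finset.prod_ite, hammingDist]

theorem prod_ite_eq_eq_pow_sub_hammingDist {K : Type*} [DecidableEq K] {N : ℕ} (k c : Fin N → K)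
    (z : ℝ) : (∏ ℓ, if k ℓ = c ℓ then z else 1) = z ^ (N - hammingDist k c) := by
  have h : Finset.card {ℓ | k ℓ = c ℓ} + hammingDist k c = N := by
    simpa [hammingDist] using Finset.card_filter_add_card_filter_not (s := Finset.univ)
      fun ℓ => k ℓ = c ℓ
  rw [← Nat.eq_sub_of_add_eq h]
  simp [Finset.prod_ite]

/-- Chernoff bound for the volume of a Hamming ball of radius `α N`. -/
theorem card_hammingBall_le {K : Type*} [Fintype K] [Nonempty K] [DecidableEq K] {N : ℕ} {α : ℝ}
    (k : Fin N → K) :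
    (∑ c : Fin N → K, if (hammingDist k c : ℝ) < α * N then (1 : ℝ) else 0) ≤
      (Fintype.card K : ℝ) ^ N * (2 * (Fintype.card K : ℝ) ^ (-(1 - α))) ^ N := by
  set κ : ℝ := ((Fintype.card K : ℕ) : ℝ) with hκ
  have hκ1 : 1 ≤ κ := by
    rw [hκ]
    exact_mod_cast Nat.succ_le_of_lt (Fintype.card_pos (α := K))
  have hκ0 : 0 < κ := by linarith
  have h1 : ∀ c : Fin N → K, (if (hammingDist k c : ℝ) < α * N then (1 : ℝ) else 0) ≤
      (κ ^ (-(1 - α))) ^ N * ∏ ℓ, if k ℓ = c ℓ then κ else 1 := fun c => by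
    rw [prod_ite_eq_eq_pow_sub_hammingDist]
    split_ifs with h
    · have hd : hammingDist k c ≤ N := by simpa using hammingDist_le_card_fintype (x := k) (y := c)
      rw [← Real.rpow_natCast, ← Real.rpow_mul hκ0.le, ← Real.rpow_natCast κ,
        ← Real.rpow_add hκ0, Nat.cast_sub hd]
      exact Real.one_le_rpow hκ1 (by linarith)
    · positivity
  calc _ ≤ ∑ c : Fin N → K, (κ ^ (-(1 - α))) ^ N * ∏ ℓ, (if k ℓ = c ℓ then κ else 1) :=
        Finset.sum_le_sum fun c _ => h1 c
    _ = (κ ^ (-(1 - α))) ^ N * ∏ ℓ : Fin N, ∑ b, (if k ℓ = b then κ else 1) := by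
      rw [← Finset.mul_sum, Fintype.prod_sum]
    _ ≤ (κ ^ (-(1 - α))) ^ N * ∏ ℓ : Fin N, (2 * κ) := by
      gcongr with ℓ
      calc (∑ b, if k ℓ = b then κ else 1) ≤ ∑ b, ((if k ℓ = b then κ else 0) + 1) :=
            Finset.sum_le_sum fun b _ => by split_ifs <;> linarith
        _ = 2 * κ := by
          rw [Finset.sum_add_distrib, Finset.sum_ite_eq]
          simp [hκ, two_mul]
    _ = _ := by
      rw [Finset.prod_const, Finset.card_univ, Fintype.card_fin, mul_pow, mul_pow]
      ring

section

variable {ι : Type*} [Fintype ι] [DecidableEq ι] {M K : ι → Type*} [∀ q, Fintype (M q)]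
  [∀ q, Fintype (K q)] [∀ q, DecidableEq (M q)] [∀ q, DecidableEq (K q)] {N : ℕ}

/-- Summing over codewords for all pairs is summing independently over the layers. -/
theorem sum_prod_layers {ι : Type*} [Fintype ι] [DecidableEq ι] {K : ι → Type*}
    [∀ q, Fintype (K q)] {N : ℕ} (g : (∀ q, K q) → ℝ) :
    ∑ a : ∀ q, Fin N → K q, ∏ ℓ, g (fun q => a q ℓ) = (∑ b, g b) ^ N := by
  rw [Fintype.sum_pow]
  exact Fintype.sum_equiv (Equiv.piComm fun q (_ : Fin N) => K q) _ _ fun a => rfl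

/-- For uniform codewords, it is unlikely that a fraction `α` of the layers are estimated
incorrectly. -/
theorem sum_far_le (p : ι) {Q : (∀ q, K q) → K p → ℝ} (hQ0 : ∀ b k, 0 ≤ Q b k)
    (hQ1 : ∀ b, ∑ k, Q b k = 1) {α ε : ℝ} (hε : 0 < ε) (hε1 : ε ≤ 1)
    (hQ : ∑ b, ∑ k with k ≠ b p, Q b k ≤ ε * Fintype.card (∀ q, K q)) :
    (∑ a : ∀ q, Fin N → K q, ∑ k with ¬ (hammingDist k (a p) : ℝ) < α * N,
      ∏ ℓ, Q (fun q => a q ℓ) (k ℓ)) ≤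
        Fintype.card (∀ q, Fin N → K q) * (2 * ε ^ α) ^ N := by
  have h1 : ∀ a : ∀ q, Fin N → K q, (∑ k with ¬ (hammingDist k (a p) : ℝ) < α * N,
      ∏ ℓ, Q (fun q => a q ℓ) (k ℓ)) ≤ (ε ^ α) ^ N *
        ∏ ℓ, ∑ k, Q (fun q => a q ℓ) k * (if k ≠ a p ℓ then ε⁻¹ else 1) := fun a => by
    rw [Fintype.prod_sum, Finset.sum_filter, Finset.mul_sum]
    refine Finset.sum_le_sum fun k _ => ?_
    have hP : 0 ≤ ∏ ℓ, Q (fun q => a q ℓ) (k ℓ) := Finset.prod_nonneg fun ℓ _ => hQ0 _ _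
    rw [Finset.prod_mul_distrib, prod_ite_ne_eq_pow_hammingDist]
    split_ifs with h
    · positivity
    · have : 1 ≤ (ε ^ α) ^ N * ε⁻¹ ^ hammingDist k (a p) := by
        rw [← Real.rpow_natCast, ← Real.rpow_mul hε.le, ← Real.rpow_natCast ε⁻¹,
          Real.inv_rpow hε.le, ← Real.rpow_neg hε.le, ← Real.rpow_add hε]
        exact Real.one_le_rpow_of_pos_of_le_one_of_nonpos hε hε1 (by linarith)
      nlinarith
  have h2 : ∑ b, ∑ k, Q b k * (if k ≠ b p then ε⁻¹ else 1) ≤ 2 * Fintype.card (∀ q, K q) :=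
    calc ∑ b, ∑ k, Q b k * (if k ≠ b p then ε⁻¹ else 1)
        ≤ ∑ b, ∑ k, (Q b k + ε⁻¹ * if k ≠ b p then Q b k else 0) := by
          refine Finset.sum_le_sum fun b _ => Finset.sum_le_sum fun k _ => ?_
          have := hQ0 b k
          split_ifs <;> linarith
      _ = Fintype.card (∀ q, K q) + ε⁻¹ * ∑ b, ∑ k with k ≠ b p, Q b k := by
          simp only [Finset.sum_add_distrib, hQ1, ← Finset.mul_sum, ← Finset.sum_filter]
          simp
      _ ≤ Fintype.card (∀ q, K q) + ε⁻¹ * (ε * Fintype.card (∀ q, K q)) := by gcongr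
      _ = 2 * Fintype.card (∀ q, K q) := by field_simp; ring
  have hc : (Fintype.card (∀ q, Fin N → K q) : ℝ) = (Fintype.card (∀ q, K q) : ℝ) ^ N := by
    simp [Fintype.card_pi, Finset.prod_pow]
  have h0 : 0 ≤ ∑ b, ∑ k, Q b k * (if k ≠ b p then ε⁻¹ else 1) :=
    Finset.sum_nonneg fun b _ => Finset.sum_nonneg fun k _ =>
      mul_nonneg (hQ0 b k) (by split_ifs <;> positivity)
  calc _ ≤ ∑ a : ∀ q, Fin N → K q, (ε ^ α) ^ N *
        ∏ ℓ, ∑ k, Q (fun q => a q ℓ) k * (if k ≠ a p ℓ then ε⁻¹ else 1) :=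
        Finset.sum_le_sum fun a _ => h1 a
    _ = (ε ^ α) ^ N * (∑ b, ∑ k, Q b k * (if k ≠ b p then ε⁻¹ else 1)) ^ N := by
      rw [← Finset.mul_sum,
        sum_prod_layers fun b => ∑ k, Q b k * (if k ≠ b p then ε⁻¹ else 1)]
    _ ≤ (ε ^ α) ^ N * (2 * Fintype.card (∀ q, K q)) ^ N := by gcongr
    _ = _ := by
      rw [hc, mul_pow, mul_pow]
      ring

/-- Averaged over all codebooks, the channel is unlikely to move the codeword of the message far. -/
theorem sum_codebook_far_le (p : ι) {Q : (∀ q, K q) → K p → ℝ} (hQ0 : ∀ b k, 0 ≤ Q b k)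
    (hQ1 : ∀ b, ∑ k, Q b k = 1) {α ε : ℝ} (hε : 0 < ε) (hε1 : ε ≤ 1)
    (hQ : ∑ b, ∑ k with k ≠ b p, Q b k ≤ ε * Fintype.card (∀ q, K q)) [∀ q, Nonempty (K q)]
    (w : ∀ q, M q) :
    (∑ φ : ∀ q, M q → Fin N → K q, ∑ k with ¬ (hammingDist k (φ p (w p)) : ℝ) < α * N,
      ∏ ℓ, Q (fun q => φ q (w q) ℓ) (k ℓ)) ≤
        Fintype.card (∀ q, M q → Fin N → K q) * (2 * ε ^ α) ^ N := by
  have h := sum_sum_reset (Ω := ∀ q, M q → Fin N → K q) (A := ∀ q, Fin N → K q)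
    (fun φ a q => Function.update (φ q) (w q) (a q)) (fun φ q => φ q (w q)) (by simp) (by simp)
    fun φ => ∑ k with ¬ (hammingDist k (φ p (w p)) : ℝ) < α * N,
      ∏ ℓ, Q (fun q => φ q (w q) ℓ) (k ℓ)
  simp only [Function.update_self] at h
  rw [Finset.sum_const, Finset.card_univ, nsmul_eq_mul] at h
  have hA : (0 : ℝ) < Fintype.card (∀ q, Fin N → K q) := by exact_mod_cast Fintype.card_pos
  refine le_of_mul_le_mul_left (h.symm.le.trans ?_) hA
  refine (mul_le_mul_of_nonneg_left (sum_far_le p hQ0 hQ1 (α := α) hε hε1 hQ)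
    (Nat.cast_nonneg _)).trans_eq ?_
  ring

/-- Averaged over all codebooks, the codeword of another message is unlikely to be close to the
estimates. -/
theorem sum_codebook_close_le (p : ι) {Q : (∀ q, K q) → K p → ℝ} (hQ0 : ∀ b k, 0 ≤ Q b k)
    (hQ1 : ∀ b, ∑ k, Q b k = 1) {α : ℝ} [∀ q, Nonempty (K q)]
    (w : ∀ q, M q) {x : M p} (hx : x ≠ w p) :
    (∑ φ : ∀ q, M q → Fin N → K q, ∑ k with (hammingDist k (φ p x) : ℝ) < α * N,
      ∏ ℓ, Q (fun q => φ q (w q) ℓ) (k ℓ)) ≤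
        Fintype.card (∀ q, M q → Fin N → K q) *
          (2 * (Fintype.card (K p) : ℝ) ^ (-(1 - α))) ^ N := by
  have h := sum_sum_reset (Ω := ∀ q, M q → Fin N → K q) (A := Fin N → K p)
    (fun φ c => Function.update φ p (Function.update (φ p) x c)) (fun φ => φ p x)
    (by simp) (by simp)
    fun φ => ∑ k with (hammingDist k (φ p x) : ℝ) < α * N,
      ∏ ℓ, Q (fun q => φ q (w q) ℓ) (k ℓ)
  have hw : ∀ (φ : ∀ q, M q → Fin N → K q) (c : Fin N → K p) (q : ι),
      Function.update φ p (Function.update (φ p) x c) q (w q) = φ q (w q) := fun φ c q => by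
    rcases eq_or_ne q p with rfl | hq
    · simp [hx.symm]
    · simp [hq]
  simp only [hw, Function.update_self] at h
  have hA : (0 : ℝ) < Fintype.card (Fin N → K p) := by exact_mod_cast Fintype.card_pos
  refine le_of_mul_le_mul_left (h.symm.le.trans ?_) hA
  have h1 : ∀ φ : ∀ q, M q → Fin N → K q, (∑ c : Fin N → K p,
      ∑ k with (hammingDist k c : ℝ) < α * N, ∏ ℓ, Q (fun q => φ q (w q) ℓ) (k ℓ)) ≤
        Fintype.card (Fin N → K p) * (2 * (Fintype.card (K p) : ℝ) ^ (-(1 - α))) ^ N := fun φ => by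
    simp only [Finset.sum_filter]
    rw [Finset.sum_comm]
    have hsum : ∑ k : Fin N → K p, ∏ ℓ, Q (fun q => φ q (w q) ℓ) (k ℓ) = 1 := by
      rw [← Fintype.prod_sum]
      simp [hQ1]
    calc _ = ∑ k : Fin N → K p, (∏ ℓ, Q (fun q => φ q (w q) ℓ) (k ℓ)) *
          ∑ c : Fin N → K p, if (hammingDist k c : ℝ) < α * N then (1 : ℝ) else 0 := by
          simp only [Finset.mul_sum, mul_ite, mul_one, mul_zero]
      _ ≤ ∑ k : Fin N → K p, (∏ ℓ, Q (fun q => φ q (w q) ℓ) (k ℓ)) *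
          ((Fintype.card (K p) : ℝ) ^ N * (2 * (Fintype.card (K p) : ℝ) ^ (-(1 - α))) ^ N) :=
          Finset.sum_le_sum fun k _ => mul_le_mul_of_nonneg_left (card_hammingBall_le k)
            (Finset.prod_nonneg fun ℓ _ => hQ0 _ _)
      _ = _ := by
          rw [← Finset.sum_mul, hsum]
          simp
  refine (Finset.sum_le_sum fun φ _ => h1 φ).trans_eq ?_
  rw [Finset.sum_const, Finset.card_univ, nsmul_eq_mul]
  ring

open Classical in
/-- Random coding for all pairs simultaneously, over channels with transition probabilities `Q p`
whose error probabilities are at most `ε` under uniform inputs.  A decoder looks for a message whose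
codeword differs from the estimates in fewer than a fraction `α` of the layers.  Since one codebook
has to serve all pairs, their bounds are added; pairs with only one message do not contribute. -/
theorem exists_codebook [∀ q, Nonempty (K q)] [∀ q, Nonempty (M q)]
    (Q : ∀ p, (∀ q, K q) → K p → ℝ) (hQ0 : ∀ p b k, 0 ≤ Q p b k) (hQ1 : ∀ p b, ∑ k, Q p b k = 1)
    (α : ℝ) {ε : ℝ} (hε : 0 < ε) (hε1 : ε ≤ 1)
    (hQ : ∀ p, ∑ b, ∑ k with k ≠ b p, Q p b k ≤ ε * Fintype.card (∀ q, K q)) :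
    ∃ (φ : ∀ q, M q → Fin N → K q) (ψ : ∀ q, (Fin N → K q) → M q), ∀ p,
      (∑ w : ∀ q, M q, ∑ k with ψ p k ≠ w p, ∏ ℓ, Q p (fun q => φ q (w q) ℓ) (k ℓ)) /
          Fintype.card (∀ q, M q) ≤
        ∑ q with Nontrivial (M q), ((2 * ε ^ α) ^ N +
          Fintype.card (M q) * (2 * (Fintype.card (K q) : ℝ) ^ (-(1 - α))) ^ N) := by
  let ψ : ∀ (φ : ∀ q, M q → Fin N → K q) (q : ι), (Fin N → K q) → M q := fun φ q k =>
    if h : ∃ x, (hammingDist k (φ q x) : ℝ) < α * N then h.choose else Classical.arbitrary _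
  set B : ι → ℝ := fun q => (2 * ε ^ α) ^ N +
    Fintype.card (M q) * (2 * (Fintype.card (K q) : ℝ) ^ (-(1 - α))) ^ N with hB
  let E : (∀ q, M q → Fin N → K q) → ι → (∀ q, M q) → ℝ := fun φ p w =>
    ∑ k with ψ φ p k ≠ w p, ∏ ℓ, Q p (fun q => φ q (w q) ℓ) (k ℓ)
  have hP0 : ∀ p (φ : ∀ q, M q → Fin N → K q) (w : ∀ q, M q) (k : Fin N → K p),
      0 ≤ ∏ ℓ, Q p (fun q => φ q (w q) ℓ) (k ℓ) := fun p φ w k =>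
    Finset.prod_nonneg fun ℓ _ => hQ0 _ _ _
  have hE0 : ∀ φ p w, 0 ≤ E φ p w := fun φ p w => Finset.sum_nonneg fun k _ => hP0 p φ w k
  have hEtriv : ∀ φ p w, ¬ Nontrivial (M p) → E φ p w = 0 := fun φ p w hp => by
    have := not_nontrivial_iff_subsingleton.1 hp
    exact Finset.sum_eq_zero fun k hk => absurd (Subsingleton.elim _ _) (Finset.mem_filter.1 hk).2
  -- a decoding error needs a distant codeword of the message or a close one of another message
  have hE : ∀ φ p w, E φ p w ≤
      (∑ k with ¬ (hammingDist k (φ p (w p)) : ℝ) < α * N,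
        ∏ ℓ, Q p (fun q => φ q (w q) ℓ) (k ℓ)) +
      ∑ x with x ≠ w p, ∑ k with (hammingDist k (φ p x) : ℝ) < α * N,
        ∏ ℓ, Q p (fun q => φ q (w q) ℓ) (k ℓ) := fun φ p w => by
    have hin : ∀ x, (∑ k with (hammingDist k (φ p x) : ℝ) < α * N,
        ∏ ℓ, Q p (fun q => φ q (w q) ℓ) (k ℓ)) = ∑ k, if (hammingDist k (φ p x) : ℝ) < α * N then
          ∏ ℓ, Q p (fun q => φ q (w q) ℓ) (k ℓ) else 0 := fun x => Finset.sum_filter _ _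
    simp only [hin]
    rw [Finset.sum_comm, Finset.sum_filter, ← Finset.sum_add_distrib]
    refine (Finset.sum_filter _ _).trans_le ?_
    refine Finset.sum_le_sum fun k _ => ?_
    have h0 := hP0 p φ w k
    have h1 : ∀ x, 0 ≤ if (hammingDist k (φ p x) : ℝ) < α * N then
        ∏ ℓ, Q p (fun q => φ q (w q) ℓ) (k ℓ) else 0 := fun x => by split_ifs <;> simp [h0]
    have h2 := Finset.sum_nonneg fun x (_ : x ∈ Finset.univ.filter fun x => x ≠ w p) => h1 x
    by_cases hc : (hammingDist k (φ p (w p)) : ℝ) < α * N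
    · have hex : ∃ x, (hammingDist k (φ p x) : ℝ) < α * N := ⟨_, hc⟩
      have hψ : ψ φ p k = hex.choose := dif_pos hex
      by_cases he : ψ φ p k = w p
      · simpa [he, hc] using h2
      · have h3 := Finset.single_le_sum (s := Finset.univ.filter fun x => x ≠ w p)
          (fun x _ => h1 x) (Finset.mem_filter.2 ⟨Finset.mem_univ (ψ φ p k), he⟩)
        rw [if_pos (hψ ▸ hex.choose_spec)] at h3
        simpa [he, hc] using h3
    · rw [if_pos hc]
      split_ifs <;> linarith
  have hsum : ∀ p w, ∑ φ, E φ p w ≤ Fintype.card (∀ q, M q → Fin N → K q) * B p := fun p w => by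
    refine (Finset.sum_le_sum fun φ _ => hE φ p w).trans ?_
    rw [Finset.sum_add_distrib, Finset.sum_comm (s := Finset.univ)]
    refine (add_le_add (sum_codebook_far_le p (hQ0 p) (hQ1 p) hε hε1 (hQ p) w)
      (Finset.sum_le_sum fun x hx => sum_codebook_close_le p (hQ0 p) (hQ1 p) w
        (Finset.mem_filter.1 hx).2)).trans ?_
    rw [Finset.sum_const, nsmul_eq_mul, hB, mul_add]
    have : ((Finset.card {x : M p | x ≠ w p} : ℕ) : ℝ) ≤ Fintype.card (M p) := by
      exact_mod_cast Finset.card_le_univ _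
    have h0 : 0 ≤ (2 * (Fintype.card (K p) : ℝ) ^ (-(1 - α))) ^ N := by positivity
    have h1 : (0 : ℝ) ≤ Fintype.card (∀ q, M q → Fin N → K q) := Nat.cast_nonneg _
    nlinarith [mul_nonneg (sub_nonneg.2 this) (mul_nonneg h1 h0)]
  obtain ⟨φ, -, hφ⟩ : ∃ φ ∈ Finset.univ, ∑ p with Nontrivial (M p), ∑ w, E φ p w ≤
      ∑ p with Nontrivial (M p), Fintype.card (∀ q, M q) * B p := by
    refine Finset.exists_le_of_sum_le Finset.univ_nonempty ?_
    rw [Finset.sum_const, Finset.card_univ, nsmul_eq_mul, Finset.sum_comm, Finset.mul_sum]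
    refine Finset.sum_le_sum fun p _ => ?_
    rw [Finset.sum_comm]
    refine (Finset.sum_le_sum fun w _ => hsum p w).trans_eq ?_
    rw [Finset.sum_const, Finset.card_univ, nsmul_eq_mul]
    ring
  refine ⟨φ, ψ φ, fun p => ?_⟩
  have hM : (0 : ℝ) < Fintype.card (∀ q, M q) := by exact_mod_cast Fintype.card_pos
  rw [div_le_iff₀ hM, mul_comm, Finset.mul_sum]
  refine le_trans ?_ hφ
  by_cases hp : Nontrivial (M p)
  · exact Finset.single_le_sum (f := fun p => ∑ w, E φ p w)
      (fun q _ => Finset.sum_nonneg fun w _ => hE0 φ q w) (by simpa using hp)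
  · refine (Finset.sum_eq_zero fun w _ => hEtriv φ p w hp).trans_le ?_
    exact Finset.sum_nonneg fun q _ => Finset.sum_nonneg fun w _ => hE0 φ q w

end

/-! ### Codes for the stacked network from codes for the network -/

namespace Code

section

variable {m : ℕ} {X : Fin m → Type u} {Y : Fin m → Type v}
  [∀ v, MeasurableSpace (X v)] [∀ v, MeasurableSpace (Y v)]
  {n : ℕ} {K : NodePair m → Type w} [∀ p, Fintype (K p)]

/-- Using a code in each layer without outer coding, all `N` layers are correct with probability
`(1 - e) ^ N`, hence the union bound. -/
theorem errorProb_layered_id_le [∀ p, Nonempty (K p)] (S : Code X Y n K) (𝒩 : Network m X Y)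
    (N : ℕ) (p : NodePair m) :
    (S.layered (fun q (w : Fin N → K q) => w) fun _ k => k).errorProb (𝒩.stack N) p ≤
      N * S.errorProb 𝒩 p := by
  classical
  set C : ℝ := ((Fintype.card (∀ q, K q) : ℕ) : ℝ) with hC
  have hC0 : 0 < C := by
    rw [hC]
    exact_mod_cast Fintype.card_pos
  set s : ℝ := ∑ b : ∀ q, K q, S.estimateProb 𝒩 p b (b p) with hs
  have hs0 : 0 ≤ s := Finset.sum_nonneg fun b _ => S.estimateProb_nonneg 𝒩 p b (b p)
  have he : S.errorProb 𝒩 p = 1 - s / C := by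
    have h : ∀ b : ∀ q, K q, ∑ k with k ≠ b p, S.estimateProb 𝒩 p b k =
        1 - S.estimateProb 𝒩 p b (b p) := fun b => by
      rw [Finset.filter_ne', ← S.sum_estimateProb 𝒩 p b, ← Finset.add_sum_erase _ _
        (Finset.mem_univ (b p)), add_sub_cancel_left]
    rw [errorProb_eq_sum_estimateProb]
    calc _ = (∑ b : ∀ q, K q, (1 - S.estimateProb 𝒩 p b (b p))) / C := by
          congr 1
          refine Finset.sum_congr rfl fun b _ => ?_
          rw [← h b]
      _ = 1 - s / C := by
          rw [Finset.sum_sub_distrib, sub_div, Finset.sum_const, Finset.card_univ, nsmul_eq_mul,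
            mul_one, ← hC, div_self hC0.ne']
  have hl : (S.layered (fun q (w : Fin N → K q) => w) fun q k => k).errorProb (𝒩.stack N) p =
      1 - (s / C) ^ N := by
    have h : ∀ w : ∀ q, Fin N → K q, ∑ k with k ≠ w p, ∏ ℓ,
        S.estimateProb 𝒩 p (fun q => w q ℓ) (k ℓ) =
        1 - ∏ ℓ, S.estimateProb 𝒩 p (fun q => w q ℓ) (w p ℓ) := fun w => by
      have h1 : ∑ k : Fin N → K p, ∏ ℓ, S.estimateProb 𝒩 p (fun q => w q ℓ) (k ℓ) = 1 := by
        rw [← Fintype.prod_sum]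
        simp [sum_estimateProb]
      rw [Finset.filter_ne', ← h1, ← Finset.add_sum_erase _ _ (Finset.mem_univ (w p)),
        add_sub_cancel_left]
    have hc : (Fintype.card (∀ q, Fin N → K q) : ℝ) = C ^ N := by
      simp [hC, Fintype.card_pi, Finset.prod_pow]
    rw [errorProb_layered, hc]
    calc _ = (∑ w : ∀ q, Fin N → K q,
          (1 - ∏ ℓ, S.estimateProb 𝒩 p (fun q => w q ℓ) (w p ℓ))) / C ^ N := by
          congr 1
          refine Finset.sum_congr rfl fun w _ => ?_
          rw [← h w]
          congr
      _ = 1 - (s / C) ^ N := by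
          rw [Finset.sum_sub_distrib,
            sum_prod_layers fun b : ∀ q, K q => S.estimateProb 𝒩 p b (b p), sub_div, div_pow,
            Finset.sum_const, Finset.card_univ, nsmul_eq_mul, mul_one, hc,
            div_self (pow_pos hC0 N).ne']
  have hB := one_add_mul_le_pow (a := s / C - 1) (by
    have := div_nonneg hs0 hC0.le
    linarith) N
  rw [hl, he]
  rw [add_sub_cancel] at hB
  linarith

open Classical in
/-- Outer codes turn a code with error probabilities at most `ε` into one for the stacked network
with exponentially small error probabilities. -/
theorem exists_layered_errorProb_le {M : NodePair m → Type*} [∀ p, Fintype (M p)]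
    [∀ p, Nonempty (M p)] [∀ p, Nonempty (K p)] (S : Code X Y n K) (𝒩 : Network m X Y) (N : ℕ)
    (α : ℝ) {ε : ℝ} (hε : 0 < ε) (hε1 : ε ≤ 1) (hS : ∀ p, S.errorProb 𝒩 p ≤ ε) :
    ∃ (φ : ∀ p, M p → Fin N → K p) (ψ : ∀ p, (Fin N → K p) → M p), ∀ p,
      (S.layered φ ψ).errorProb (𝒩.stack N) p ≤
        ∑ q with Nontrivial (M q), ((2 * ε ^ α) ^ N +
          Fintype.card (M q) * (2 * (Fintype.card (K q) : ℝ) ^ (-(1 - α))) ^ N) := by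
  have hC : (0 : ℝ) < Fintype.card (∀ q, K q) := by exact_mod_cast Fintype.card_pos
  obtain ⟨φ, ψ, h⟩ := exists_codebook (M := M) (K := K) (N := N) (fun p => S.estimateProb 𝒩 p)
    (S.estimateProb_nonneg 𝒩) (S.sum_estimateProb 𝒩) α hε hε1 fun p => by
      have := hS p
      rw [errorProb_eq_sum_estimateProb, div_le_iff₀ hC] at this
      refine le_trans (le_of_eq ?_) this
      congr
  refine ⟨φ, ψ, fun p => ?_⟩
  rw [errorProb_layered]
  refine le_trans (le_of_eq ?_) (h p)
  congr

end

end Code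

/-! ### Rates -/

theorem card_message {m : ℕ} (n : ℕ) (R : RateVector m) (p : NodePair m) :
    Fintype.card (Message n R p) = ⌈(2 : ℝ) ^ ((n : ℝ) * R p)⌉₊ := Fintype.card_fin _

instance nonempty_message {m : ℕ} (n : ℕ) (R : RateVector m) (p : NodePair m) :
    Nonempty (Message n R p) :=
  Fin.pos_iff_nonempty.1 (Nat.ceil_pos.2 (Real.rpow_pos_of_pos two_pos _))

theorem le_card_message {m : ℕ} (n : ℕ) (R : RateVector m) (p : NodePair m) :
    (2 : ℝ) ^ ((n : ℝ) * R p) ≤ Fintype.card (Message n R p) := by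
  rw [card_message]
  exact Nat.le_ceil _

theorem card_message_le {m : ℕ} (n : ℕ) {R : RateVector m} {p : NodePair m} (h : 0 ≤ R p) :
    (Fintype.card (Message n R p) : ℝ) ≤ 2 * (2 : ℝ) ^ ((n : ℝ) * R p) := by
  have h1 : (1 : ℝ) ≤ (2 : ℝ) ^ ((n : ℝ) * R p) :=
    Real.one_le_rpow one_le_two (mul_nonneg (Nat.cast_nonneg n) h)
  rw [card_message]
  have := Nat.ceil_lt_add_one (zero_le_one.trans h1)
  linarith

theorem le_card_stackMessage {m : ℕ} (N n : ℕ) (R : RateVector m) (p : NodePair m) :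
    (2 : ℝ) ^ (((N * n : ℕ) : ℝ) * R p) ≤ Fintype.card (StackMessage N n R p) := by
  have h := pow_le_pow_left₀ (by positivity) (le_card_message n R p) N
  rw [← Real.rpow_natCast, ← Real.rpow_mul two_pos.le] at h
  refine (le_of_eq ?_).trans (h.trans_eq ?_)
  · congr 1
    push_cast
    ring
  · simp

theorem exists_rpow_le {α c : ℝ} (hα : 0 < α) (hc : 0 < c) :
    ∃ ε : ℝ, 0 < ε ∧ ε ≤ 1 ∧ ε ^ α ≤ c := by
  have hc' : 0 < c ^ α⁻¹ := Real.rpow_pos_of_pos hc _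
  refine ⟨min 1 (c ^ α⁻¹), lt_min one_pos hc', min_le_left _ _, ?_⟩
  calc (min 1 (c ^ α⁻¹)) ^ α ≤ (c ^ α⁻¹) ^ α :=
        Real.rpow_le_rpow (lt_min one_pos hc').le (min_le_right _ _) hα.le
    _ = c := Real.rpow_inv_rpow hc.le hα.ne'

/-- If `|K| ≥ 2 ^ a` and `b + d ≤ (1 - α) a`, codewords from `K` have more than enough room for
`2 ^ b` messages per letter. -/
theorem rpow_mul_card_rpow_le {κ a b d α : ℝ} (hκ : (2 : ℝ) ^ a ≤ κ) (hα : α ≤ 1)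
    (h : b + d ≤ (1 - α) * a) : (2 : ℝ) ^ b * κ ^ (-(1 - α)) ≤ (2 : ℝ) ^ (-d) := by
  have h1 : κ ^ (-(1 - α)) ≤ ((2 : ℝ) ^ a) ^ (-(1 - α)) :=
    Real.rpow_le_rpow_of_nonpos (by positivity) hκ (by linarith)
  calc (2 : ℝ) ^ b * κ ^ (-(1 - α)) ≤ (2 : ℝ) ^ b * ((2 : ℝ) ^ a) ^ (-(1 - α)) := by gcongr
    _ = (2 : ℝ) ^ (b - (1 - α) * a) := by
      rw [← Real.rpow_mul two_pos.le, ← Real.rpow_add two_pos]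
      congr 1
      ring
    _ ≤ (2 : ℝ) ^ (-d) := Real.rpow_le_rpow_of_exponent_le one_le_two (by linarith)

namespace Network

section

variable {m : ℕ} {X : Fin m → Type u} {Y : Fin m → Type v}
  [∀ v, MeasurableSpace (X v)] [∀ v, MeasurableSpace (Y v)]

theorem hasStackSolution_of_hasSolution {𝒩 : Network m X Y} {n : ℕ} {ε : ℝ} {R : RateVector m}
    (N : ℕ) (hε : 0 < ε) (h : 𝒩.HasSolution n (ε / (N + 1)) R) : 𝒩.HasStackSolution N n ε R := by
  obtain ⟨S, hS⟩ := h
  refine ⟨S.layered (fun q (w : Fin N → Message n R q) => w) fun q k => k, fun p => ?_⟩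
  have h0 : (0 : ℝ) < N + 1 := by positivity
  calc _ ≤ N * S.errorProb 𝒩 p := S.errorProb_layered_id_le 𝒩 N p
    _ ≤ N * (ε / (N + 1)) := by
      have := (hS p).le
      gcongr
    _ < ε := by
      rw [mul_div_assoc', div_lt_iff₀ h0]
      nlinarith

theorem rateRegion_subset_stackRateRegion (𝒩 : Network m X Y) :
    𝒩.rateRegion ⊆ 𝒩.stackRateRegion := by
  refine closure_mono fun R hR => ⟨hR.1, fun ε hε => ⟨0, fun N _ => ?_⟩⟩
  obtain ⟨n₀, hn₀⟩ := hR.2 (ε / (N + 1)) (by positivity)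
  exact ⟨max n₀ 1, le_max_right _ _,
    hasStackSolution_of_hasSolution N hε (hn₀ _ (le_max_left _ _))⟩

/-- Long codes for the network, obtained from codes for the stacked network by using the layers in
succession. -/
theorem exists_long_code {𝒩 : Network m X Y} {R : RateVector m}
    (h : ∀ ε : ℝ, 0 < ε → ∃ N₀ : ℕ, ∀ N ≥ N₀, ∃ n : ℕ, 1 ≤ n ∧ 𝒩.HasStackSolution N n ε R)
    {ε : ℝ} (hε : 0 < ε) (L₀ : ℕ) :
    ∃ L N n : ℕ, L = N * n ∧ 1 ≤ L ∧ 1 ≤ n ∧ L₀ ≤ L ∧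
      ∃ S : Code X Y L (StackMessage N n R), ∀ p, S.errorProb 𝒩 p ≤ ε := by
  obtain ⟨N₀, hN₀⟩ := h ε hε
  obtain ⟨n, hn, S, hS⟩ := hN₀ (max N₀ (max L₀ 1)) (le_max_left _ _)
  have hN : 1 ≤ max N₀ (max L₀ 1) := (le_max_right _ _).trans (le_max_right _ _)
  refine ⟨_, max N₀ (max L₀ 1), n, rfl, Nat.mul_pos hN hn, hn, ?_, S.serial hN, fun p => ?_⟩
  · exact ((le_max_left L₀ 1).trans (le_max_right _ _)).trans (Nat.le_mul_of_pos_right _ hn)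
  · rw [Code.errorProb_serial]
    exact (hS p).le

end

end Network

/-! ### The rate regions and stacked solutions -/

namespace Network

section

variable {m : ℕ} {X : Fin m → Type u} {Y : Fin m → Type v}
  [∀ v, MeasurableSpace (X v)] [∀ v, MeasurableSpace (Y v)]

/-- Rates achieved on the stacked network are achieved on the network itself after any proportional
reduction: a long code of fixed blocklength `L` is used about `n' / L` times in succession, with an
outer code. -/
theorem exists_hasSolution_smul {𝒩 : Network m X Y} {R : RateVector m} (hR : ∀ p, 0 ≤ R p)
    (h : ∀ ε : ℝ, 0 < ε → ∃ N₀ : ℕ, ∀ N ≥ N₀, ∃ n : ℕ, 1 ≤ n ∧ 𝒩.HasStackSolution N n ε R)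
    {η : ℝ} (hη : 0 < η) (hη1 : η < 1) {ε : ℝ} (hε : 0 < ε) :
    ∃ n₀ : ℕ, ∀ n ≥ n₀, 𝒩.HasSolution n ε ((1 - η) • R) := by
  classical
  -- the gap of `L η R / 2` bits per letter left by the outer code should be at least two bits
  obtain ⟨L₀, hL₀⟩ : ∃ L₀ : ℕ, ∀ p, 0 < R p → 2 ≤ L₀ * (η / 2 * R p) := by
    have h1 : ∀ p, ∃ l : ℕ, 0 < R p → 2 ≤ l * (η / 2 * R p) := fun p => by
      by_cases hp : 0 < R p
      · obtain ⟨l, hl⟩ := Archimedean.arch (2 : ℝ) (show 0 < η / 2 * R p by positivity)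
        exact ⟨l, fun _ => by simpa using hl⟩
      · exact ⟨0, fun h => absurd h hp⟩
    choose l hl using h1
    refine ⟨∑ p, l p, fun p hp => (hl p hp).trans ?_⟩
    have : (l p : ℝ) ≤ ((∑ p, l p : ℕ) : ℝ) := by
      exact_mod_cast Finset.single_le_sum (fun q _ => Nat.zero_le (l q)) (Finset.mem_univ p)
    gcongr
  obtain ⟨lam, hlam0, hlam1, hlam⟩ := exists_rpow_le (half_pos hη) (c := 1 / 4) (by norm_num)
  obtain ⟨L, N, n, hLdef, hL0, -, hL, S, hS⟩ := exists_long_code h hlam0 L₀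
  have : ∀ v, Nonempty (X v) := S.nonempty_input hL0
  set C : ℝ := ∑ q, (1 + 2 * (2 : ℝ) ^ ((L : ℝ) * R q)) with hC
  have hC0 : 0 ≤ C := by positivity
  obtain ⟨J₀, hJ₀⟩ := exists_pow_lt_of_lt_one (show 0 < ε / (C + 1) by positivity)
    (show (1 / 2 : ℝ) < 1 by norm_num)
  refine ⟨L * (J₀ + 1), fun n' hn' => ?_⟩
  set J := n' / L with hJ
  have hJ1 : J₀ + 1 ≤ J := (Nat.le_div_iff_mul_le hL0).2 (by rwa [mul_comm])
  have hJn : J * L ≤ n' := Nat.div_mul_le_self n' L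
  have hnJ : (n' : ℝ) ≤ L * J + L := by
    have := Nat.lt_mul_div_succ n' hL0
    exact_mod_cast (this.trans_eq (Nat.mul_succ L _)).le
  obtain ⟨φ, ψ, hφ⟩ := S.exists_layered_errorProb_le (M := Message n' ((1 - η) • R)) 𝒩 J (η / 2)
    hlam0 hlam1 hS
  refine ⟨((S.layered φ ψ).serial (by omega)).extend hJn, fun p => ?_⟩
  rw [Code.errorProb_extend, Code.errorProb_serial]
  refine (hφ p).trans_lt ?_
  have hterm : ∀ q, Nontrivial (Message n' ((1 - η) • R) q) →
      (2 * lam ^ (η / 2)) ^ J + Fintype.card (Message n' ((1 - η) • R) q) *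
        (2 * (Fintype.card (StackMessage N n R q) : ℝ) ^ (-(1 - η / 2))) ^ J ≤
      (1 + 2 * (2 : ℝ) ^ ((L : ℝ) * R q)) * (1 / 2) ^ J := fun q hq => by
    -- a pair of rate zero has only one message
    have hRq : 0 < R q := by
      refine (hR q).lt_of_ne fun h0 => ?_
      have h1 : Fintype.card (Message n' ((1 - η) • R) q) = 1 := by
        rw [card_message]
        simp [← h0]
      exact absurd (Fintype.one_lt_card_iff_nontrivial.2 hq) (by omega)
    have hK := rpow_mul_card_rpow_le (b := L * ((1 - η) * R q)) (d := L * (η / 2 * R q))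
      (α := η / 2) (le_card_stackMessage N n R q) (by linarith) (by rw [← hLdef]; linarith)
    have hd : (2 : ℝ) ^ (-(L * (η / 2 * R q))) ≤ 1 / 4 := by
      have h2 : (L₀ : ℝ) * (η / 2 * R q) ≤ L * (η / 2 * R q) := by gcongr
      calc (2 : ℝ) ^ (-(L * (η / 2 * R q))) ≤ (2 : ℝ) ^ (-2 : ℝ) :=
            Real.rpow_le_rpow_of_exponent_le one_le_two (by linarith [hL₀ q hRq])
        _ = 1 / 4 := by rw [Real.rpow_neg two_pos.le]; norm_num
    have hM : (Fintype.card (Message n' ((1 - η) • R) q) : ℝ) ≤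
        2 * (2 : ℝ) ^ ((L : ℝ) * R q) * ((2 : ℝ) ^ (L * ((1 - η) * R q))) ^ J := by
      have h1 : 0 ≤ (1 - η) * R q := mul_nonneg (by linarith) (hR q)
      refine (card_message_le n' h1).trans ?_
      rw [mul_assoc, ← Real.rpow_natCast, ← Real.rpow_mul two_pos.le, ← Real.rpow_add two_pos]
      have h2 : (n' : ℝ) * ((1 - η) * R q) ≤ (L * J + L) * ((1 - η) * R q) := by gcongr
      have h3 : (L : ℝ) * ((1 - η) * R q) ≤ L * R q := by
        have := mul_nonneg hη.le (hR q)
        gcongr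
        linarith
      have h4 : (n' : ℝ) * ((1 - η) • R) q ≤ L * R q + L * ((1 - η) * R q) * J := by
        simp only [Pi.smul_apply, smul_eq_mul]
        linarith
      have := Real.rpow_le_rpow_of_exponent_le one_le_two h4
      linarith
    set κ : ℝ := (Fintype.card (StackMessage N n R q) : ℝ) ^ (-(1 - η / 2)) with hκ
    have hκ0 : 0 ≤ κ := by positivity
    calc _ ≤ (2 * (1 / 4)) ^ J + 2 * (2 : ℝ) ^ ((L : ℝ) * R q) *
          ((2 : ℝ) ^ (L * ((1 - η) * R q))) ^ J * (2 * κ) ^ J := by gcongr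
      _ = (1 / 2) ^ J + 2 * (2 : ℝ) ^ ((L : ℝ) * R q) *
          (2 * ((2 : ℝ) ^ (L * ((1 - η) * R q)) * κ)) ^ J := by
        rw [mul_assoc (2 * (2 : ℝ) ^ ((L : ℝ) * R q)), ← mul_pow]
        ring_nf
      _ ≤ (1 / 2) ^ J + 2 * (2 : ℝ) ^ ((L : ℝ) * R q) * (2 * (1 / 4)) ^ J := by
        have := hK.trans hd
        gcongr
      _ = _ := by ring
  calc _ ≤ ∑ q with Nontrivial (Message n' ((1 - η) • R) q),
        (1 + 2 * (2 : ℝ) ^ ((L : ℝ) * R q)) * (1 / 2) ^ J :=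
        Finset.sum_le_sum fun q hq => hterm q (Finset.mem_filter.1 hq).2
    _ ≤ ∑ q, (1 + 2 * (2 : ℝ) ^ ((L : ℝ) * R q)) * (1 / 2) ^ J :=
        Finset.sum_le_sum_of_subset_of_nonneg (Finset.filter_subset _ _) fun q _ _ => by positivity
    _ = C * (1 / 2) ^ J := (Finset.sum_mul ..).symm
    _ ≤ C * (1 / 2) ^ J₀ := by
        have := pow_le_pow_of_le_one (show (0 : ℝ) ≤ 1 / 2 by norm_num) (by norm_num)
          ((Nat.le_succ J₀).trans hJ1)
        gcongr
    _ ≤ C * (ε / (C + 1)) := by gcongr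
    _ < ε := by
        rw [mul_div_assoc', div_lt_iff₀ (by positivity)]
        nlinarith

theorem stackRateRegion_subset_rateRegion (𝒩 : Network m X Y) :
    𝒩.stackRateRegion ⊆ 𝒩.rateRegion := by
  refine closure_minimal (fun R hR => ?_) isClosed_closure
  have hlim : Filter.Tendsto (fun η : ℝ => (1 - η) • R) (nhdsWithin 0 (Set.Ioi 0)) (nhds R) := by
    have h : Continuous fun η : ℝ => (1 - η) • R := by fun_prop
    simpa using (h.tendsto 0).mono_left nhdsWithin_le_nhds
  refine mem_closure_of_tendsto hlim ?_
  filter_upwards [Ioo_mem_nhdsGT (zero_lt_one' ℝ)] with η hη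
  exact ⟨fun p => mul_nonneg (by linarith [hη.2]) (hR.1 p), fun ε hε =>
    exists_hasSolution_smul hR.1 hR.2 hη.1 hη.2 hε⟩

theorem nonneg_of_mem_stackRateRegion {𝒩 : Network m X Y} {R : RateVector m}
    (hR : R ∈ 𝒩.stackRateRegion) (p : NodePair m) : 0 ≤ R p :=
  closure_minimal (t := {R : RateVector m | 0 ≤ R p}) (fun _ h => h.1 p)
    (isClosed_le continuous_const (continuous_apply p)) hR

/-- Below an interior point of a closure there is room: some point of the set itself dominates it
by a margin in all coordinates. -/
theorem exists_add_le_of_mem_interior_closure {ι : Type*} [Fintype ι] {A : Set (ι → ℝ)} {R : ι → ℝ}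
    (hR : R ∈ interior (closure A)) : ∃ η : ℝ, 0 < η ∧ ∃ T ∈ A, ∀ p, R p + η ≤ T p := by
  obtain ⟨r, hr, hball⟩ := Metric.isOpen_iff.1 isOpen_interior R hR
  have hmem : (fun p => R p + r / 2) ∈ closure A := by
    refine interior_subset (hball ?_)
    rw [Metric.mem_ball]
    refine lt_of_le_of_lt ((dist_pi_le_iff (by positivity : 0 ≤ r / 2)).2 fun p => ?_)
      (half_lt_self hr)
    simp [abs_of_pos hr]
  obtain ⟨T, hT, hd⟩ := Metric.mem_closure_iff.1 hmem (r / 4) (by positivity)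
  refine ⟨r / 4, by positivity, T, hT, fun p => ?_⟩
  have h1 := (dist_le_pi_dist (fun p => R p + r / 2) T p).trans_lt hd
  rw [Real.dist_eq] at h1
  linarith [(abs_lt.1 h1).2]

/-- The decay rate of the error probability is adjusted to be one bit per layer, by choosing the
inner blocklength large and the inner error probability small. -/
theorem exists_hasStackedSolution {𝒩 : Network m X Y} {R : RateVector m}
    (hR : R ∈ interior 𝒩.stackRateRegion) :
    ∃ n : ℕ, 1 ≤ n ∧ ∃ δ : ℝ, 0 < δ ∧ ∃ R' : RateVector m, (∀ p, R p < R' p) ∧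
      ∀ N : ℕ, 1 ≤ N → 𝒩.HasStackedSolution N n ((2 : ℝ) ^ (-((N : ℝ) * δ))) R R' := by
  classical
  have hR0 := nonneg_of_mem_stackRateRegion (interior_subset hR)
  obtain ⟨η, hη, T, hT, hRT⟩ := exists_add_le_of_mem_interior_closure hR
  obtain ⟨α, hα0, hα1, hα⟩ : ∃ α : ℝ, 0 < α ∧ α ≤ 1 ∧ ∀ p, α * T p ≤ η / 2 := by
    have hB : 0 ≤ ∑ p, T p := Finset.sum_nonneg fun p _ => hT.1 p
    refine ⟨η / (2 * (∑ p, T p + η)), by positivity, ?_, fun p => ?_⟩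
    · rw [div_le_one (by positivity)]
      linarith
    · have := Finset.single_le_sum (fun q _ => hT.1 q) (Finset.mem_univ p)
      rw [div_mul_eq_mul_div, div_le_iff₀ (by positivity)]
      nlinarith
  set P : ℝ := ((Fintype.card (NodePair m) : ℕ) : ℝ) with hP
  have hP0 : 0 ≤ P := Nat.cast_nonneg _
  -- with this `c` the error bound `2 c ^ N`, summed over all pairs, is below `2 ^ (-N)` for `N ≥ 1`
  set c : ℝ := 1 / (8 * (P + 1)) with hc
  have hc0 : 0 < c := by positivity
  obtain ⟨L₀, hL₀⟩ := exists_pow_lt_of_lt_one (show 0 < c / 4 by positivity)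
    (show (2 : ℝ) ^ (-(η / 2)) < 1 from Real.rpow_lt_one_of_one_lt_of_neg one_lt_two (by linarith))
  obtain ⟨lam, hlam0, hlam1, hlam⟩ := exists_rpow_le hα0 (half_pos hc0)
  obtain ⟨L, N₁, n₁, hLdef, hL0, hn₁, hL, S, hS⟩ := exists_long_code hT.2 hlam0 L₀
  have hn₁0 : (0 : ℝ) < n₁ := by exact_mod_cast hn₁
  have hA0 : ∀ p, (0 : ℝ) < Fintype.card (Message n₁ T p) := fun p => by
    exact_mod_cast Fintype.card_pos
  -- inner rates for which `2 ^ (L R')` is exactly the number of messages of the long code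
  set R' : RateVector m := fun p => Real.logb 2 (Fintype.card (Message n₁ T p)) / n₁ with hR'
  have hcard : ∀ p, Fintype.card (Message L R' p) = Fintype.card (StackMessage N₁ n₁ T p) := by
    intro p
    have h1 : (2 : ℝ) ^ ((L : ℝ) * R' p) = ((Fintype.card (Message n₁ T p) ^ N₁ : ℕ) : ℝ) := by
      have h2 : (L : ℝ) * R' p = Real.logb 2 (Fintype.card (Message n₁ T p)) * N₁ := by
        rw [hR', hLdef]
        push_cast
        field_simp
      rw [h2, Real.rpow_mul two_pos.le, Real.rpow_logb two_pos (by norm_num) (hA0 p),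
        Real.rpow_natCast]
      push_cast
      rfl
    rw [card_message, h1, Nat.ceil_natCast]
    simp
  have hTR' : ∀ p, T p ≤ R' p := fun p => by
    rw [hR', le_div_iff₀ hn₁0, Real.le_logb_iff_rpow_le one_lt_two (hA0 p), mul_comm]
    exact le_card_message n₁ T p
  refine ⟨L, hL0, 1, one_pos, R', fun p => by linarith [hRT p, hTR' p], fun N hN => ?_⟩
  set S' : Code X Y L (Message L R') := S.relabel fun p => Fintype.equivOfCardEq (hcard p) with hS'
  obtain ⟨φ, ψ, hφ⟩ := S'.exists_layered_errorProb_le (M := StackMessage N L R) 𝒩 N α hlam0 hlam1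
    fun p => by
      rw [hS', Code.errorProb_relabel]
      exact hS p
  refine ⟨⟨φ, S', ψ⟩, fun p => (hφ p).trans_lt ?_⟩
  have hterm : ∀ q, (2 * lam ^ α) ^ N + Fintype.card (StackMessage N L R q) *
      (2 * (Fintype.card (Message L R' q) : ℝ) ^ (-(1 - α))) ^ N ≤ 2 * c ^ N := fun q => by
    have hK := rpow_mul_card_rpow_le (b := L * R q) (d := L * (η / 2)) (α := α)
      (le_card_stackMessage N₁ n₁ T q) hα1 (by
        rw [← hLdef]
        have : (L : ℝ) * (R q + η / 2) ≤ L * ((1 - α) * T q) := by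
          have := hα q
          have := hRT q
          gcongr
          linarith
        linarith)
    have hd : (2 : ℝ) ^ (-(L * (η / 2))) ≤ c / 4 := by
      have h1 : (2 : ℝ) ^ (-(L * (η / 2))) = ((2 : ℝ) ^ (-(η / 2))) ^ L := by
        rw [← Real.rpow_natCast, ← Real.rpow_mul two_pos.le]
        ring_nf
      rw [h1]
      exact (pow_le_pow_of_le_one (by positivity)
        (Real.rpow_le_one_of_one_le_of_nonpos one_le_two (by linarith)) hL).trans hL₀.le
    have hM : (Fintype.card (StackMessage N L R q) : ℝ) ≤ (2 * (2 : ℝ) ^ ((L : ℝ) * R q)) ^ N := by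
      have := pow_le_pow_left₀ (by positivity) (card_message_le L (hR0 q)) N
      simpa using this
    rw [hcard]
    set κ : ℝ := (Fintype.card (StackMessage N₁ n₁ T q) : ℝ) ^ (-(1 - α)) with hκ
    have hκ0 : 0 ≤ κ := by positivity
    calc _ ≤ (2 * (c / 2)) ^ N + (2 * (2 : ℝ) ^ ((L : ℝ) * R q)) ^ N * (2 * κ) ^ N := by gcongr
      _ = (2 * (c / 2)) ^ N + (4 * ((2 : ℝ) ^ ((L : ℝ) * R q) * κ)) ^ N := by
        rw [← mul_pow]
        ring_nf
      _ ≤ (2 * (c / 2)) ^ N + (4 * (c / 4)) ^ N := by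
        have := hK.trans hd
        gcongr
      _ = 2 * c ^ N := by ring
  calc _ ≤ ∑ q with Nontrivial (StackMessage N L R q), 2 * c ^ N :=
        Finset.sum_le_sum fun q _ => hterm q
    _ ≤ ∑ _q : NodePair m, 2 * c ^ N :=
        Finset.sum_le_sum_of_subset_of_nonneg (Finset.filter_subset _ _) fun q _ _ => by positivity
    _ = 2 * P * c ^ N := by
        rw [Finset.sum_const, Finset.card_univ, nsmul_eq_mul, ← hP]
        ring
    _ = 2 * P / (P + 1) ^ N * (1 / 4) ^ N * (1 / 2) ^ N := by
        rw [hc, one_div, mul_inv, mul_pow, show (8 : ℝ)⁻¹ = 1 / 4 * (1 / 2) by norm_num, mul_pow,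
          inv_pow]
        ring
    _ < 1 * (1 / 2) ^ N := by
        have h1 : P + 1 ≤ (P + 1) ^ N := le_self_pow₀ (by linarith) (by omega)
        have h2 : 2 * P / (P + 1) ^ N ≤ 2 := by
          rw [div_le_iff₀ (by positivity)]
          linarith
        have h3 : (1 / 4 : ℝ) ^ N ≤ 1 / 4 := by
          simpa using pow_le_pow_of_le_one (show (0 : ℝ) ≤ 1 / 4 by norm_num) (by norm_num) hN
        have h4 : 2 * P / (P + 1) ^ N * (1 / 4) ^ N ≤ 2 * (1 / 4) := by gcongr
        have h5 : (0 : ℝ) < (1 / 2) ^ N := by positivity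
        nlinarith
    _ = (2 : ℝ) ^ (-((N : ℝ) * 1)) := by
        rw [one_mul, mul_one, Real.rpow_neg two_pos.le, Real.rpow_natCast, one_div, inv_pow]

end

end Network

theorem mainTheorem3 {m : ℕ} {X : Fin m → Type u} {Y : Fin m → Type v}
    [∀ v, MeasurableSpace (X v)] [∀ v, MeasurableSpace (Y v)] (𝒩 : Network m X Y) :
    𝒩.rateRegion = 𝒩.stackRateRegion ∧
      ∀ R ∈ interior 𝒩.stackRateRegion,
        ∃ n : ℕ, 1 ≤ n ∧ ∃ δ : ℝ, 0 < δ ∧ ∃ R' : RateVector m, (∀ p, R p < R' p) ∧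
          ∀ N : ℕ, 1 ≤ N → 𝒩.HasStackedSolution N n ((2 : ℝ) ^ (-((N : ℝ) * δ))) R R' :=
  ⟨(𝒩.rateRegion_subset_stackRateRegion).antisymm 𝒩.stackRateRegion_subset_rateRegion,
    fun _ hR => Network.exists_hasStackedSolution hR⟩
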